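/- Let $d\in\mathbb N$, $\alpha>0$, $\gamma\in\mathbb R^d$, and let $\nu$ be a finite Borel measure on $\mathbb R^d$ with $\nu(\{0\})=0$ and $\int_{|x|\le 2}|x|^2\,\nu(dx)+\int_{|x|>2}(\log|x|)^\alpha\,\nu(dx)<\infty$. For $\beta\in\mathbb R^d$ and a Borel measure $M$ on $\mathbb R^d$ with $M(\{0\})=0$ and $\int(|x|\wedge 1)\,M(dx)<\infty$, let $\mathrm{ID}_0(M,\beta)$ be the infinitely divisible distribution with characteristic function $z\mapsto\exp\{i\langle\beta,z\rangle+\int_{\mathbb R^d}(e^{i\langle z,x\rangle}-1)\,M(dx)\}$, and let $L^*_\alpha(\nu,\gamma)=\mathrm{ID}_0(M_\alpha,\gamma)$, where $M_\alpha(B)=\int_{\mathbb R^d}\int_0^1 1_B(yr)(-\log r)^{\alpha-1}r^{-1}\,dr\,\nu(dy)$ for Borel $B\subseteq\mathbb R^d$. For a Lévy process $Y=\{Y_t:t\ge0\}$ on $\mathbb R^d$ and a measurable $f:[0,\infty)\to\mathbb R$, integrals $\int_B f(s)\,dY_s$ over bounded Borel sets $B\subset[0,\infty)$ are taken with respect to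 the independently scattered random measure $\Lambda$ with $\Lambda((s,t])=Y_t-Y_s$ and $\Lambda(\{0\})=0$ a.s.: $f$ is locally integrable if there are simple functions $f_n\to f$ a.e. such that $\int_B f_n\,d\Lambda$ converges in probability for every bounded Borel $B$, and $\int_B f(s)\,dY_s$ is the limit. The improper integral $\int_0^\infty f(s)\,dY_s$ is definable if $f$ is locally integrable and $\int_{[0,t]}f(s)\,dY_s$ converges in probability as $t\to\infty$; its value is the limit. It is absolutely definable if it is definable and $\int_0^\infty|C(f(s)z)|\,ds<\infty$ for all $z\in\mathbb R^d$, where $C$ is the cumulant function of $Y_1$, that is, the continuous function with $C(0)=0$ and $\mathrm E\,e^{i\langle z,Y_1\rangle}=e^{C(z)}$. **Theorem.** Let $X\sim L^*_\alpha(\nu,\gamma)$, let $\theta>0$, and let $Y=\{Y_t:t\ge0\}$ be a Lévy process on $\mathbb R^d$ with $Y_1\sim\mathrm{ID}_0(\nu/\theta,\gamma/(\theta\Gamma(\alpha)))$. Then the stochastic integral $\int_0^\infty e^{-(\alpha s/\theta)^{1/\alpha}}\,dY_s$ is absolutely definable, and $$X\stackrel{d}{=}\int_0^\infty e^{-(\alpha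 s/\theta)^{1/\alpha}}\,dY_s.$$ -/

import Mathlib

open MeasureTheory ProbabilityTheory Filter Topology
open scoped NNReal ENNReal

noncomputable section

/-- The exponent `i⟨γ,z⟩ + ∫ (e^{i⟨z,x⟩} - 1) M(dx)`. -/
def cgfID0 {d : ℕ} (M : Measure (EuclideanSpace ℝ (Fin d))) (γ z : EuclideanSpace ℝ (Fin d)) : ℂ :=
  Complex.I * (inner ℝ γ z : ℝ) + ∫ x, (Complex.exp (Complex.I * (inner ℝ z x : ℝ)) - 1) ∂M

/-- `μ = ID₀(M, γ)`: the infinitely divisible distribution of finite variation with Lévy measure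
`M`, drift `γ` and no Gaussian part. -/
structure IsID0 {d : ℕ} (M : Measure (EuclideanSpace ℝ (Fin d))) (γ : EuclideanSpace ℝ (Fin d))
    (μ : Measure (EuclideanSpace ℝ (Fin d))) : Prop where
  isProbabilityMeasure : IsProbabilityMeasure μ
  zero : M {0} = 0
  lintegral_lt_top : ∫⁻ x, ENNReal.ofReal (min ‖x‖ 1) ∂M < ∞
  charFun_eq : ∀ z, charFun μ z = Complex.exp (cgfID0 M γ z)

/-- The measure `(-log r)^(α-1) r⁻¹ dr` on `(0,1)`. -/
def logPowerMeasure (α : ℝ) : Measure ℝ :=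
  (volume.restrict (Set.Ioo (0 : ℝ) 1)).withDensity
    (fun r => ENNReal.ofReal ((-Real.log r) ^ (α - 1) * r⁻¹))

/-- The measure `M_α(B) = ∫ ∫_0^1 1_B(y r) (-log r)^(α-1) r⁻¹ dr ν(dy)`. -/
def levyMeasureOfBDLM {d : ℕ} (α : ℝ) (ν : Measure (EuclideanSpace ℝ (Fin d))) :
    Measure (EuclideanSpace ℝ (Fin d)) :=
  (ν.prod (logPowerMeasure α)).map (fun p => p.2 • p.1)

/-- `μ = L*_α(ν, γ)`. -/
structure IsLStar {d : ℕ} (α : ℝ) (ν : Measure (EuclideanSpace ℝ (Fin d)))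
    (γ : EuclideanSpace ℝ (Fin d)) (μ : Measure (EuclideanSpace ℝ (Fin d))) : Prop where
  pos : 0 < α
  isFiniteMeasure : IsFiniteMeasure ν
  zero : ν {0} = 0
  lintegral_lt_top :
    (∫⁻ x in {x | ‖x‖ ≤ 2}, ENNReal.ofReal (‖x‖ ^ 2) ∂ν) +
      (∫⁻ x in {x | 2 < ‖x‖}, ENNReal.ofReal (Real.log ‖x‖ ^ α) ∂ν) < ∞
  isID0 : IsID0 (levyMeasureOfBDLM α ν) γ μ

/-- Lévy processes on `ℝ^d`. -/
structure IsLevyProcess {d : ℕ} {Ω : Type*} [MeasurableSpace Ω] (P : Measure Ω)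
    (Y : ℝ≥0 → Ω → EuclideanSpace ℝ (Fin d)) : Prop where
  measurable : ∀ t, Measurable (Y t)
  zero : ∀ᵐ ω ∂P, Y 0 ω = 0
  indep : HasIndepIncrements Y P
  stationary : ∀ s t, IdentDistrib (Y (s + t) - Y s) (Y t) P P
  stochContinuous : ∀ t, TendstoInMeasure P Y (𝓝 t) (Y t)
  cadlag : ∀ᵐ ω ∂P, ∀ t, ContinuousWithinAt (fun s => Y s ω) (Set.Ici t) t ∧
    ∃ l, Tendsto (fun s => Y s ω) (𝓝[<] t) (𝓝 l)

/-- Lebesgue measure on `[0,∞)`. -/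
def lebesgueNNReal : Measure ℝ≥0 := (volume : Measure ℝ).comap ((↑) : ℝ≥0 → ℝ)

/-- Bounded Borel subsets of `[0,∞)`. -/
def IsBddBorel (B : Set ℝ≥0) : Prop := MeasurableSet B ∧ Bornology.IsBounded B

/-- `M` is the independently scattered random measure on the bounded Borel subsets of `[0,∞)`
induced by the process `Y`, that is, with `M((s,t]) = Y_t - Y_s` almost surely. The values of `M` on
other sets carry no meaning. -/
structure IsRandomMeasureOf {d : ℕ} {Ω : Type*} [MeasurableSpace Ω] (P : Measure Ω)
    (Y : ℝ≥0 → Ω → EuclideanSpace ℝ (Fin d))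
    (M : Set ℝ≥0 → Ω → EuclideanSpace ℝ (Fin d)) : Prop where
  measurable : ∀ B, IsBddBorel B → Measurable (M B)
  singleton_zero : ∀ᵐ ω ∂P, M {0} ω = 0
  Ioc : ∀ s t, s ≤ t → ∀ᵐ ω ∂P, M (Set.Ioc s t) ω = Y t ω - Y s ω
  indep : ∀ (n : ℕ) (B : Fin n → Set ℝ≥0), (∀ i, IsBddBorel (B i)) →
    Pairwise (fun i j => Disjoint (B i) (B j)) → iIndepFun (fun i => M (B i)) P
  sigmaAdditive : ∀ B : ℕ → Set ℝ≥0, (∀ i, IsBddBorel (B i)) →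
    Pairwise (fun i j => Disjoint (B i) (B j)) → IsBddBorel (⋃ i, B i) →
    TendstoInMeasure P (fun n ω => ∑ i ∈ Finset.range n, M (B i) ω) atTop (M (⋃ i, B i))

/-- The integral over `B` of a simple function, `∫_B ∑ a_j 1_{B_j} dM = ∑ a_j M(B ∩ B_j)`. -/
def simpleStochIntegral {d : ℕ} {Ω : Type*} (M : Set ℝ≥0 → Ω → EuclideanSpace ℝ (Fin d))
    (g : SimpleFunc ℝ≥0 ℝ) (B : Set ℝ≥0) (ω : Ω) : EuclideanSpace ℝ (Fin d) :=
  ∑ a ∈ g.range, a • M (B ∩ g ⁻¹' {a}) ω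

/-- `f` is locally integrable with respect to the random measure `M`, and `J B = ∫_B f dM` for all
bounded Borel sets `B`: for some simple functions converging to `f` almost everywhere, the integrals
over every bounded Borel set `B` converge in probability to `J B`. -/
def IsStochIntegral {d : ℕ} {Ω : Type*} [MeasurableSpace Ω] (P : Measure Ω)
    (M : Set ℝ≥0 → Ω → EuclideanSpace ℝ (Fin d)) (f : ℝ≥0 → ℝ)
    (J : Set ℝ≥0 → Ω → EuclideanSpace ℝ (Fin d)) : Prop :=
  ∃ g : ℕ → SimpleFunc ℝ≥0 ℝ,
    (∀ᵐ s ∂lebesgueNNReal, Tendsto (fun n => g n s) atTop (𝓝 (f s))) ∧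
    ∀ B, IsBddBorel B → TendstoInMeasure P (fun n => simpleStochIntegral M (g n) B) atTop (J B)

/-- The improper stochastic integral `∫_0^∞ f(s) dY_s` is definable and is (a version of) `Z`:
`f` is locally integrable and `∫_0^t f(s) dY_s → Z` in probability as `t → ∞`. -/
def IsImproperStochIntegral {d : ℕ} {Ω : Type*} [MeasurableSpace Ω] (P : Measure Ω)
    (Y : ℝ≥0 → Ω → EuclideanSpace ℝ (Fin d)) (f : ℝ≥0 → ℝ)
    (Z : Ω → EuclideanSpace ℝ (Fin d)) : Prop :=
  ∃ M J, IsRandomMeasureOf P Y M ∧ IsStochIntegral P M f J ∧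
    TendstoInMeasure P (fun t : ℝ≥0 => J (Set.Iic t)) atTop Z

/-- `C` is the cumulant function of `μ`: the unique continuous function with `C(0) = 0` and
`μ̂ = exp C`. -/
def IsCumulant {d : ℕ} (μ : Measure (EuclideanSpace ℝ (Fin d)))
    (C : EuclideanSpace ℝ (Fin d) → ℂ) : Prop :=
  Continuous C ∧ C 0 = 0 ∧ ∀ z, charFun μ z = Complex.exp (C z)

/-- `∫_0^∞ f(s) dY_s` is absolutely definable: it is definable, and
`∫_0^∞ |C(f(s) z)| ds < ∞` for every `z`, where `C` is the cumulant function of `Y_1`. -/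
def IsAbsolutelyDefinable {d : ℕ} {Ω : Type*} [MeasurableSpace Ω] (P : Measure Ω)
    (Y : ℝ≥0 → Ω → EuclideanSpace ℝ (Fin d)) (f : ℝ≥0 → ℝ) : Prop :=
  (∃ Z, IsImproperStochIntegral P Y f Z) ∧
    ∃ C, IsCumulant (P.map (Y 1)) C ∧
      ∀ z, Integrable (fun s : ℝ≥0 => C (f s • z)) lebesgueNNReal

end

/-! Let C be the cumulant function of Y_1 and f(s) = exp(-(αs/θ)^{1/α}). The substitution r = f(s)
carries Lebesgue measure on [0,∞) to θ (-log r)^{α-1} r^{-1} dr on (0,1)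
(`map_expKernel_lebesgueNNReal`). By Fubini and ⟨rz, x⟩ = ⟨z, rx⟩, the integral ∫ C(f(s)z) ds is
therefore the exponent of ID₀(M_α, γ): the factor θ cancels the one in ν/θ, and ∫ f = θΓ(α) cancels
the normalisation of the drift (`integral_cgfID0_expKernel`). Absolute convergence comes from the
same substitution, since e^{i⟨z,x⟩} - 1 is bounded by a multiple of |x| ∧ 1, which is
M_α-integrable.

What remains is a general fact, `exists_isImproperStochIntegral`: for bounded measurable f, if ∫
|C(f(s)z)| ds < ∞ for all z, then ∫ f dY is definable with characteristic function exp ∫ C(f(s)z)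
ds. The integral is built by hand. For a step function h, independent stationary increments give E
exp(i∫⟨h,dY⟩) = exp ∫ C(h(s)) ds (`integral_exp_stepIntegral`). As C is continuous with C(0) = 0,
bounded convergence h_n → 0 on a bounded interval makes the characteristic functions of the
integrals tend to 1, hence the integrals tend to 0 in probability (`tendsto_stepIntegral_zero`).
With completeness of L⁰ the integral extends to bounded measurable functions of bounded support, and
linearity and the exponential formula pass to the limit. Indicators then give the random measure,
and one more dominated convergence argument gives the limit t → ∞. -/

set_option linter.unusedSectionVars false

noncomputable section

/-! ### Algebra of convergence in probability. -/

namespace MeasureTheory.TendstoInMeasure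

variable {Ω ι E F : Type*} [MeasurableSpace Ω] {μ : Measure Ω} {l : Filter ι}
  [NormedAddCommGroup E] [NormedAddCommGroup F]

theorem add {f f' : ι → Ω → E} {g g' : Ω → E} (h : TendstoInMeasure μ f l g)
    (h' : TendstoInMeasure μ f' l g') :
    TendstoInMeasure μ (fun i ω => f i ω + f' i ω) l (fun ω => g ω + g' ω) := by
  rw [tendstoInMeasure_iff_norm] at *
  intro ε hε
  have := (h (ε / 2) (by positivity)).add (h' (ε / 2) (by positivity))
  rw [add_zero] at this
  refine tendsto_of_tendsto_of_tendsto_of_le_of_le tendsto_const_nhds this (fun _ => zero_le)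
    fun i => (measure_mono fun ω hω => ?_).trans (measure_union_le _ _)
  by_contra hc
  simp only [Set.mem_union, Set.mem_ofPred_eq, not_or, not_le] at hc hω
  have : ‖f i ω + f' i ω - (g ω + g' ω)‖ ≤ ‖f i ω - g ω‖ + ‖f' i ω - g' ω‖ := by
    rw [add_sub_add_comm]
    exact norm_add_le _ _
  linarith

theorem lipschitz_comp {f : ι → Ω → E} {g : Ω → E} {K : ℝ≥0} {φ : E → F} (hφ : LipschitzWith K φ)
    (h : TendstoInMeasure μ f l g) :
    TendstoInMeasure μ (fun i ω => φ (f i ω)) l (fun ω => φ (g ω)) := by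
  rw [tendstoInMeasure_iff_dist] at *
  intro ε hε
  have hK : (0 : ℝ) < K + 1 := by positivity
  refine tendsto_of_tendsto_of_tendsto_of_le_of_le tendsto_const_nhds (h (ε / (K + 1))
    (by positivity)) (fun _ => zero_le) fun i => measure_mono fun ω hω => ?_
  simp only [Set.mem_ofPred_eq] at hω ⊢
  rw [div_le_iff₀ hK]
  have := hφ.dist_le_mul (f i ω) (g ω)
  nlinarith [dist_nonneg (x := f i ω) (y := g ω)]

theorem neg {f : ι → Ω → E} {g : Ω → E} (h : TendstoInMeasure μ f l g) :
    TendstoInMeasure μ (fun i ω => - f i ω) l (fun ω => - g ω) :=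
  h.lipschitz_comp (LipschitzWith.id.neg)

theorem sub {f f' : ι → Ω → E} {g g' : Ω → E} (h : TendstoInMeasure μ f l g)
    (h' : TendstoInMeasure μ f' l g') :
    TendstoInMeasure μ (fun i ω => f i ω - f' i ω) l (fun ω => g ω - g' ω) := by
  simpa only [sub_eq_add_neg] using h.add h'.neg

theorem const_smul [NormedSpace ℝ E] {f : ι → Ω → E} {g : Ω → E} (c : ℝ)
    (h : TendstoInMeasure μ f l g) :
    TendstoInMeasure μ (fun i ω => c • f i ω) l (fun ω => c • g ω) :=
  h.lipschitz_comp (lipschitzWith_smul c)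

theorem const (g : Ω → E) : TendstoInMeasure μ (fun _ : ι => g) l g := by
  rw [tendstoInMeasure_iff_norm]
  intro ε hε
  simpa [not_le.2 hε] using tendsto_const_nhds

theorem of_sub {f : ι → Ω → E} {g : Ω → E}
    (h : TendstoInMeasure μ (fun i ω => f i ω - g ω) l 0) : TendstoInMeasure μ f l g := by
  rw [tendstoInMeasure_iff_norm] at *
  simpa using h

theorem finsetSum {κ : Type*} (s : Finset κ) {f : κ → ι → Ω → E} {g : κ → Ω → E}
    (h : ∀ k ∈ s, TendstoInMeasure μ (f k) l (g k)) :
    TendstoInMeasure μ (fun i ω => ∑ k ∈ s, f k i ω) l (fun ω => ∑ k ∈ s, g k ω) := by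
  classical
  induction s using Finset.induction_on with
  | empty => simpa using const _
  | insert a s ha ih =>
    simp only [Finset.sum_insert ha]
    exact (h a (by simp)).add (ih fun k hk => h k (by simp [hk]))

/-- A vector is the sum of its coordinates times basis vectors, and each summand is a Lipschitz
image of one coordinate. -/
theorem euclidean {d : ℕ} {f : ι → Ω → EuclideanSpace ℝ (Fin d)} {g : Ω → EuclideanSpace ℝ (Fin d)}
    (h : ∀ j, TendstoInMeasure μ (fun i ω => f i ω j) l (fun ω => g ω j)) :
    TendstoInMeasure μ f l g := by
  have key (x : EuclideanSpace ℝ (Fin d)) : ∑ j, x j • EuclideanSpace.single j (1 : ℝ) = x := by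
    ext j
    simp [Finset.sum_apply, Pi.single_apply]
  have := finsetSum Finset.univ fun j _ => (h j).lipschitz_comp
    ((ContinuousLinearMap.toSpanSingleton ℝ (EuclideanSpace.single j (1 : ℝ))).lipschitz)
  simpa [key] using this

end MeasureTheory.TendstoInMeasure

/-! ### Completeness of L⁰, and convergence in probability through characteristic functions. -/

section

variable {Ω ι E : Type*} [MeasurableSpace Ω] {P : Measure Ω} {l : Filter ι}

/-- `L⁰` is complete for convergence in measure. -/
theorem exists_tendstoInMeasure_of_cauchy [IsFiniteMeasure P] [NormedAddCommGroup E]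
    [CompleteSpace E] {X : ℕ → Ω → E} (hX : ∀ n, AEStronglyMeasurable (X n) P)
    (h : TendstoInMeasure P (fun (p : ℕ × ℕ) ω => X p.1 ω - X p.2 ω) (atTop ×ˢ atTop) 0) :
    ∃ Z, StronglyMeasurable Z ∧ TendstoInMeasure P X atTop Z := by
  have h' := h
  rw [tendstoInMeasure_iff_norm] at h'
  have hev (k : ℕ) : ∀ᶠ N in atTop, ∀ n ≥ N, ∀ m ≥ N,
      P {ω | (1 / 2 : ℝ) ^ k ≤ ‖X n ω - X m ω‖} ≤ (2⁻¹ : ℝ≥0∞) ^ k := by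
    have := (h' ((1 / 2 : ℝ) ^ k) (by positivity)).eventually_le_const
      (u := (2⁻¹ : ℝ≥0∞) ^ k) (ENNReal.pow_pos (by simp) _)
    rw [prod_atTop_atTop_eq, eventually_atTop] at this
    obtain ⟨⟨a, b⟩, hab⟩ := this
    filter_upwards [eventually_ge_atTop a, eventually_ge_atTop b] with N ha hb n hn m hm
    simpa using hab (n, m) ⟨ha.trans hn, hb.trans hm⟩
  obtain ⟨φ, hφ, hφN⟩ := extraction_forall_of_eventually hev
  have hsum : ∑' k, P {ω | (1 / 2 : ℝ) ^ k ≤ ‖X (φ k) ω - X (φ (k + 1)) ω‖} ≠ ∞ := by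
    refine ne_top_of_le_ne_top ?_ (ENNReal.tsum_le_tsum fun k =>
      hφN k (φ k) le_rfl (φ (k + 1)) (hφ.monotone (Nat.le_succ k)))
    rw [ENNReal.tsum_geometric]
    simp
  have hlim : ∀ᵐ ω ∂P, ∃ z, Tendsto (fun k => X (φ k) ω) atTop (𝓝 z) := by
    -- Borel–Cantelli: almost surely, all but finitely many consecutive differences along φ are
    -- below a geometric sequence.
    filter_upwards [ae_eventually_notMem hsum] with ω hω
    refine cauchySeq_tendsto_of_complete (cauchySeq_of_summable_dist ?_)
    refine Summable.of_norm_bounded_eventually_nat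
      (summable_geometric_of_lt_one (r := (1 / 2 : ℝ)) (by norm_num) (by norm_num)) ?_
    filter_upwards [hω] with k hk
    simp only [not_le] at hk
    simpa [dist_eq_norm] using hk.le
  obtain ⟨Z, hZm, hZ⟩ := exists_stronglyMeasurable_limit_of_tendsto_ae (fun k => hX (φ k)) hlim
  refine ⟨Z, hZm, ?_⟩
  have h1 := tendstoInMeasure_of_tendsto_ae (fun k => hX (φ k)) hZ
  -- The Cauchy property along the pairs (n, φ n) transfers the limit from the subsequence to the
  -- whole sequence.
  have h2 := h.comp (tendsto_id.prodMk hφ.tendsto_atTop)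
  have h3 := h2.add h1
  simpa using h3

theorem tendsto_integral_exp_of_tendstoInMeasure [IsProbabilityMeasure P] [l.IsCountablyGenerated]
    {X : ι → Ω → ℝ} {Z : Ω → ℝ} (hX : ∀ i, AEMeasurable (X i) P) (hZ : AEMeasurable Z P)
    (h : TendstoInMeasure P X l Z) :
    Tendsto (fun i => ∫ ω, Complex.exp (X i ω * Complex.I) ∂P) l
      (𝓝 (∫ ω, Complex.exp (Z ω * Complex.I) ∂P)) := by
  have := (h.tendstoInDistribution_of_aemeasurable hX hZ).tendsto
  replace this := (ProbabilityMeasure.tendsto_iff_forall_integral_rclike_tendsto ℂ).1 this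
  have key (W : Ω → ℝ) (hW : AEMeasurable W P) :
      ∫ ω, Complex.exp (W ω * Complex.I) ∂P =
        ∫ x, BoundedContinuousFunction.innerProbChar (1 : ℝ) x ∂(P.map W) := by
    rw [← charFun_eq_integral_innerProbChar, charFun_apply_real, integral_map hW (by fun_prop)]
    simp
  simp_rw [key _ (hX _), key _ hZ]
  exact this (BoundedContinuousFunction.innerProbChar (1 : ℝ))

/-- The tail P(|X| > r) is at most (r/2)‖∫ (1 - φ_X(t)) dt‖ over |t| ≤ 2/r, and this integral tends
to 0 by dominated convergence. This is what turns estimates on the cumulant into convergence in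
probability. -/
theorem tendstoInMeasure_zero_of_tendsto_integral_exp [IsProbabilityMeasure P]
    [l.IsCountablyGenerated] {X : ι → Ω → ℝ} (hX : ∀ i, AEMeasurable (X i) P)
    (h : ∀ u : ℝ, Tendsto (fun i => ∫ ω, Complex.exp ((u * X i ω : ℝ) * Complex.I) ∂P) l (𝓝 1)) :
    TendstoInMeasure P X l 0 := by
  have hch (i : ι) (u : ℝ) :
      charFun (P.map (X i)) u = ∫ ω, Complex.exp ((u * X i ω : ℝ) * Complex.I) ∂P := by
    rw [charFun_apply_real, integral_map (hX i) (by fun_prop)]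
    simp
  have hprob (i : ι) : IsProbabilityMeasure (P.map (X i)) := Measure.isProbabilityMeasure_map (hX i)
  rw [tendstoInMeasure_iff_measureReal_norm]
  intro ε hε
  -- The tail bound is for the strict inequality r < |x|, while the event to be covered is ε ≤ |x|.
  set r := ε / 2 with hr
  have hint : Tendsto (fun i => ∫ t in (-2 * r⁻¹)..(2 * r⁻¹), 1 - charFun (P.map (X i)) t) l
      (𝓝 (∫ t in (-2 * r⁻¹)..(2 * r⁻¹), (0 : ℂ))) := by
    refine intervalIntegral.tendsto_integral_filter_of_dominated_convergence (fun _ => 2)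
      (Eventually.of_forall fun i => ?_) (Eventually.of_forall fun i => ?_) (by simp) ?_
    · exact (measurable_const.sub measurable_charFun).aestronglyMeasurable
    · exact Eventually.of_forall fun t _ => norm_one_sub_charFun_le_two
    · refine Eventually.of_forall fun t _ => ?_
      simpa [hch] using (tendsto_const_nhds (x := (1 : ℂ))).sub (h t)
  have hbd := (hint.norm.const_mul (2⁻¹ * r))
  simp only [intervalIntegral.integral_zero, norm_zero, mul_zero] at hbd
  refine tendsto_of_tendsto_of_tendsto_of_le_of_le tendsto_const_nhds hbd
    (fun _ => measureReal_nonneg) fun i => ?_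
  refine le_trans ?_ (measureReal_abs_gt_le_integral_charFun (μ := P.map (X i)) (r := r)
    (by positivity))
  rw [measureReal_def, measureReal_def,
    Measure.map_apply_of_aemeasurable (hX i) (measurableSet_lt (by fun_prop) (by fun_prop))]
  refine ENNReal.toReal_mono (measure_ne_top _ _) (measure_mono fun ω hω => ?_)
  simp only [Set.mem_ofPred_eq, Pi.zero_apply, sub_zero, Real.norm_eq_abs, Set.mem_preimage] at *
  linarith
end

end

/-! ### Marginal laws of a Lévy process. -/

noncomputable section

variable {d : ℕ} {Ω : Type*} [MeasurableSpace Ω] {P : Measure Ω} [IsProbabilityMeasure P]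
  {Y : ℝ≥0 → Ω → EuclideanSpace ℝ (Fin d)}

/-- The quotient of the two sides is continuous with values in the finite set of N-th roots of
unity, so it is constant on a preconnected space. This selects the correct branch for the law of Y
at time 1/N. -/
theorem eq_exp_div_of_pow_eq_exp {E : Type*} [TopologicalSpace E] [PreconnectedSpace E]
    {g ψ : E → ℂ} {N : ℕ} (hN : N ≠ 0) (hg : Continuous g) (hψ : Continuous ψ) {x₀ : E}
    (hg0 : g x₀ = 1) (hψ0 : ψ x₀ = 0) (h : ∀ x, g x ^ N = Complex.exp (ψ x)) (x : E) :
    g x = Complex.exp (ψ x / N) := by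
  let r : E → ℂ := fun x => g x * Complex.exp (-(ψ x / N))
  have hr : Continuous r := by fun_prop
  have hrN (x : E) : r x ^ N = 1 := by
    simp only [r, mul_pow, h, ← Complex.exp_nat_mul, ← Complex.exp_add]
    rw [mul_neg, mul_div_cancel₀ _ (by exact_mod_cast hN)]
    simp
  have hfin : {w : ℂ | w ^ N = 1}.Finite :=
    (Polynomial.nthRoots N (1 : ℂ)).toFinset.finite_toSet.subset fun w hw => by
      simpa [Polynomial.mem_nthRoots (Nat.pos_of_ne_zero hN)] using hw
  have hconst := isPreconnected_univ.constant_of_mapsTo hfin.isDiscrete hr.continuousOn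
    (fun x _ => hrN x) (Set.mem_univ x) (Set.mem_univ x₀)
  have h1 : g x * Complex.exp (-(ψ x / N)) = 1 := by
    simpa [r, hg0, hψ0] using hconst
  rw [Complex.exp_neg, mul_inv_eq_one₀ (Complex.exp_ne_zero _)] at h1
  exact h1

namespace IsLevyProcess

theorem charFun_add (hY : IsLevyProcess P Y) (s t : ℝ≥0) (z : EuclideanSpace ℝ (Fin d)) :
    charFun (P.map (Y (s + t))) z = charFun (P.map (Y s)) z * charFun (P.map (Y t)) z := by
  have hind := hY.indep.indepFun_eval_sub (zero_le (a := s)) (le_self_add (b := t)) hY.zero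
  have := hind.charFun_map_add_eq_mul (hY.measurable s).aemeasurable
    ((hY.measurable _).sub (hY.measurable s)).aemeasurable
  rw [add_sub_cancel, (hY.stationary s t).map_eq] at this
  exact congrFun this z

theorem charFun_zero (hY : IsLevyProcess P Y) (z : EuclideanSpace ℝ (Fin d)) :
    charFun (P.map (Y 0)) z = 1 := by
  rw [charFun_apply, integral_map (hY.measurable 0).aemeasurable (by fun_prop)]
  rw [integral_congr_ae (g := fun _ => 1)]
  · simp
  · filter_upwards [hY.zero] with ω hω
    simp [hω]

theorem charFun_nsmul (hY : IsLevyProcess P Y) (n : ℕ) (t : ℝ≥0) (z : EuclideanSpace ℝ (Fin d)) :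
    charFun (P.map (Y (n * t))) z = charFun (P.map (Y t)) z ^ n := by
  induction n with
  | zero => simpa using hY.charFun_zero z
  | succ n ih => rw [Nat.cast_succ, add_mul, one_mul, hY.charFun_add, ih, pow_succ]

omit [IsProbabilityMeasure P] in
theorem charFun_eq_integral (hY : IsLevyProcess P Y) (t : ℝ≥0) (z : EuclideanSpace ℝ (Fin d)) :
    charFun (P.map (Y t)) z = ∫ ω, Complex.exp ((inner ℝ z (Y t ω) : ℝ) * Complex.I) ∂P := by
  rw [charFun_apply, integral_map (hY.measurable t).aemeasurable (by fun_prop)]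
  simp_rw [real_inner_comm]

theorem continuous_charFun_time (hY : IsLevyProcess P Y) (z : EuclideanSpace ℝ (Fin d)) :
    Continuous fun t => charFun (P.map (Y t)) z := by
  simp_rw [hY.charFun_eq_integral]
  refine continuous_iff_continuousAt.2 fun t => ?_
  have hm (t : ℝ≥0) : AEMeasurable (fun ω => (inner ℝ z (Y t ω) : ℝ)) P :=
    (measurable_const.inner (hY.measurable t)).aemeasurable
  exact tendsto_integral_exp_of_tendstoInMeasure hm (hm t)
    ((hY.stochContinuous t).lipschitz_comp (innerSL ℝ z).lipschitz)

/-- Continuous N-th roots settle the times 1/N, multiplicativity the rational times, and stochastic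
continuity with density all the others. -/
theorem charFun_eq (hY : IsLevyProcess P Y) {ψ : EuclideanSpace ℝ (Fin d) → ℂ}
    (hψ : IsCumulant (P.map (Y 1)) ψ) (t : ℝ≥0) (z : EuclideanSpace ℝ (Fin d)) :
    charFun (P.map (Y t)) z = Complex.exp ((t : ℝ) * ψ z) := by
  have hroot (N : ℕ) (hN : N ≠ 0) (z : EuclideanSpace ℝ (Fin d)) :
      charFun (P.map (Y (N : ℝ≥0)⁻¹)) z = Complex.exp (ψ z / N) := by
    have : IsProbabilityMeasure (P.map (Y (N : ℝ≥0)⁻¹)) :=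
      Measure.isProbabilityMeasure_map (hY.measurable _).aemeasurable
    refine eq_exp_div_of_pow_eq_exp hN continuous_charFun hψ.1 (x₀ := 0) (by simp) hψ.2.1
      (fun z => ?_) z
    rw [← hY.charFun_nsmul, mul_inv_cancel₀ (by exact_mod_cast hN), hψ.2.2]
  refine congrFun (DenseRange.equalizer (f := ((↑) : ℚ≥0 → ℝ≥0)) ?_ (hY.continuous_charFun_time z)
    (by fun_prop : Continuous fun t : ℝ≥0 => Complex.exp ((t : ℝ) * ψ z)) ?_) t
  · refine dense_of_exists_between fun a b hab => ?_
    obtain ⟨q, hq⟩ := exists_rat_btwn (NNReal.coe_lt_coe.2 hab)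
    have hq0 : 0 ≤ q := by exact_mod_cast (a.2.trans_lt hq.1).le
    lift q to ℚ≥0 using hq0
    exact ⟨(q : ℝ≥0), ⟨q, rfl⟩, by exact_mod_cast hq.1, by exact_mod_cast hq.2⟩
  · ext q
    simp only [Function.comp_apply]
    rw [NNRat.cast_def, div_eq_mul_inv, hY.charFun_nsmul, hroot _ q.den_ne_zero,
      ← Complex.exp_nat_mul]
    push_cast
    congr 1
    ring

end IsLevyProcess

end

/-! ### Lebesgue measure on [0,∞), and sums of indicators of disjoint sets. -/

noncomputable section

section Lebesgue

theorem measurableEmbedding_nnreal_coe : MeasurableEmbedding ((↑) : ℝ≥0 → ℝ) :=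
  MeasurableEmbedding.subtype_coe (measurableSet_Ici : MeasurableSet (Set.Ici (0 : ℝ)))

theorem map_coe_lebesgueNNReal :
    lebesgueNNReal.map ((↑) : ℝ≥0 → ℝ) = volume.restrict (Set.Ici 0) := by
  rw [lebesgueNNReal, measurableEmbedding_nnreal_coe.map_comap]
  congr 1
  ext x
  exact ⟨fun ⟨y, hy⟩ => hy ▸ y.2, fun hx => ⟨⟨x, hx⟩, rfl⟩⟩

theorem lebesgueNNReal_Ioc (a b : ℝ≥0) :
    lebesgueNNReal (Set.Ioc a b) = ENNReal.ofReal ((b : ℝ) - a) := by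
  rw [lebesgueNNReal, measurableEmbedding_nnreal_coe.comap_apply, ← Real.volume_Ioc]
  congr 1
  ext x
  constructor
  · rintro ⟨y, hy, rfl⟩
    exact ⟨by exact_mod_cast hy.1, by exact_mod_cast hy.2⟩
  · rintro ⟨h1, h2⟩
    exact ⟨⟨x, a.2.trans h1.le⟩, ⟨by exact_mod_cast h1, by exact_mod_cast h2⟩, rfl⟩

theorem lebesgueNNReal_singleton (a : ℝ≥0) : lebesgueNNReal {a} = 0 := by
  rw [lebesgueNNReal, measurableEmbedding_nnreal_coe.comap_apply]
  simp

theorem lebesgueNNReal_Iic_lt_top (a : ℝ≥0) : lebesgueNNReal (Set.Iic a) < ∞ := by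
  have : Set.Iic a ⊆ {0} ∪ Set.Ioc 0 a := fun x hx => by
    rcases eq_or_ne x 0 with rfl | h
    · simp
    · exact Or.inr ⟨pos_iff_ne_zero.2 h, hx⟩
  refine (measure_mono this).trans_lt ((measure_union_le _ _).trans_lt ?_)
  rw [lebesgueNNReal_singleton, lebesgueNNReal_Ioc]
  simp

end Lebesgue

theorem sum_indicator_eq_of_pairwiseDisjoint {S ι E : Type*} [AddCommMonoid E] {s : Finset ι}
    {A : ι → Set S} (hA : (s : Set ι).PairwiseDisjoint A) (w : ι → E) {x : S} {k : ι}
    (hk : k ∈ s) (hx : x ∈ A k) : ∑ j ∈ s, (A j).indicator (fun _ => w j) x = w k := by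
  rw [Finset.sum_eq_single_of_mem k hk fun j hj hjk => Set.indicator_of_notMem
    (fun hxj => Set.disjoint_left.1 (hA hj hk hjk) hxj hx) _]
  simp [hx]

theorem sum_indicator_eq_zero {S ι E : Type*} [AddCommMonoid E] {s : Finset ι}
    {A : ι → Set S} (w : ι → E) {x : S} (hx : ∀ k ∈ s, x ∉ A k) :
    ∑ j ∈ s, (A j).indicator (fun _ => w j) x = 0 :=
  Finset.sum_eq_zero fun j hj => Set.indicator_of_notMem (hx j hj) _

/-- A function vanishing at zero commutes with sums of constants over disjoint sets. -/
theorem comp_sum_indicator_of_pairwiseDisjoint {S ι E F : Type*} [AddCommMonoid E]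
    [AddCommMonoid F] {ψ : E → F} (hψ : ψ 0 = 0) (s : Finset ι) (A : ι → Set S)
    (hA : (s : Set ι).PairwiseDisjoint A) (w : ι → E) (x : S) :
    ψ (∑ k ∈ s, (A k).indicator (fun _ => w k) x) =
      ∑ k ∈ s, (A k).indicator (fun _ => ψ (w k)) x := by
  by_cases h : ∃ k ∈ s, x ∈ A k
  · obtain ⟨k, hk, hx⟩ := h
    rw [sum_indicator_eq_of_pairwiseDisjoint hA w hk hx,
      sum_indicator_eq_of_pairwiseDisjoint hA (fun k => ψ (w k)) hk hx]
  · push Not at h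
    rw [sum_indicator_eq_zero w h, sum_indicator_eq_zero (fun k => ψ (w k)) h, hψ]

/-! ### Step functions, encoded by finitely supported families of jumps. -/

section Step

variable {Ω E : Type*} [NormedAddCommGroup E] [InnerProductSpace ℝ E]

/-- The step function `s ↦ ∑_{t ≥ s} e t`. -/
def stepFun : (ℝ≥0 →₀ E) →ₗ[ℝ] (ℝ≥0 → E) :=
  Finsupp.lsum ℝ fun t =>
    { toFun := fun c => (Set.Iic t).indicator fun _ => c
      map_add' := fun a b => by
        ext s
        by_cases h : s ∈ Set.Iic t <;> simp [Set.indicator, h]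
      map_smul' := fun r a => by
        ext s
        by_cases h : s ∈ Set.Iic t <;> simp [Set.indicator, h] }

/-- The integral `∑_t ⟨e t, Y_t⟩` of `stepFun e` against a process `Y` with `Y_0 = 0`. -/
def stepIntegral (Y : ℝ≥0 → Ω → E) : (ℝ≥0 →₀ E) →ₗ[ℝ] (Ω → ℝ) :=
  Finsupp.lsum ℝ fun t =>
    { toFun := fun c ω => inner ℝ c (Y t ω)
      map_add' := fun a b => by ext ω; simp [inner_add_left]
      map_smul' := fun r a => by ext ω; simp [inner_smul_left] }

@[simp]
theorem stepFun_single (t : ℝ≥0) (c : E) :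
    stepFun (Finsupp.single t c) = (Set.Iic t).indicator fun _ => c :=
  Finsupp.sum_single_index (by ext; simp)

@[simp]
theorem stepIntegral_single (Y : ℝ≥0 → Ω → E) (t : ℝ≥0) (c : E) :
    stepIntegral Y (Finsupp.single t c) = fun ω => inner ℝ c (Y t ω) :=
  Finsupp.sum_single_index (by ext; simp)

theorem stepFun_single_sub_single {a b : ℝ≥0} (hab : a ≤ b) (c : E) :
    stepFun (Finsupp.single b c - Finsupp.single a c) = (Set.Ioc a b).indicator fun _ => c := by
  rw [map_sub, stepFun_single, stepFun_single]
  ext s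
  by_cases h1 : s ≤ a
  · simp [Set.indicator, h1, h1.trans hab, not_lt.2 h1]
  · by_cases h2 : s ≤ b <;> simp [Set.indicator, h1, h2, not_le.1 h1]

theorem stepIntegral_single_sub_single (Y : ℝ≥0 → Ω → E) (a b : ℝ≥0) (c : E) :
    stepIntegral Y (Finsupp.single b c - Finsupp.single a c) =
      fun ω => inner ℝ c (Y b ω - Y a ω) := by
  ext ω
  simp [inner_sub_right]

theorem measurable_stepFun [MeasurableSpace E] [BorelSpace E] [SecondCountableTopology E]
    (e : ℝ≥0 →₀ E) : Measurable (stepFun e) := by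
  induction e using Finsupp.induction_linear with
  | zero => rw [map_zero]; exact measurable_const
  | add f g hf hg => rw [map_add]; exact hf.add hg
  | single t c => rw [stepFun_single]; exact measurable_const.indicator measurableSet_Iic

theorem measurable_stepIntegral [MeasurableSpace Ω] [MeasurableSpace E] [BorelSpace E]
    [SecondCountableTopology E] {Y : ℝ≥0 → Ω → E} (hY : ∀ t, Measurable (Y t)) (e : ℝ≥0 →₀ E) :
    Measurable (stepIntegral Y e) := by
  induction e using Finsupp.induction_linear with
  | zero => rw [map_zero]; exact measurable_const
  | add f g hf hg => rw [map_add]; exact hf.add hg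
  | single t c => rw [stepIntegral_single]; exact measurable_const.inner (hY t)

omit [InnerProductSpace ℝ E] in
-- Summation by parts over the sorted support: the value on a cell is the sum of all later jumps. It
-- rewrites a step integral as a sum over successive increments, which are independent.
theorem exists_eq_sum_single_sub_single (e : ℝ≥0 →₀ E) :
    ∃ (n : ℕ) (t : ℕ → ℝ≥0) (w : ℕ → E) (c : E),
    Monotone t ∧ e = Finsupp.single 0 c +
      ∑ k ∈ Finset.range n, (Finsupp.single (t (k + 1)) (w k) - Finsupp.single (t k) (w k)) := by
  classical
  -- Time 0 is included so that the grid starts there.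
  set S := insert 0 e.support with hS
  have h0 : 0 < S.card := Finset.card_pos.2 ⟨0, by simp [hS]⟩
  -- The clamped index makes the grid constant past its last point, so it is monotone on all of ℕ.
  let t : ℕ → ℝ≥0 := fun k => S.orderEmbOfFin rfl ⟨min k (S.card - 1), by omega⟩
  have ht : Monotone t := fun i j hij => (S.orderEmbOfFin rfl).monotone (Fin.mk_le_mk.2 (by omega))
  have ht0 : t 0 = 0 := by
    have : t 0 = S.min' ⟨0, by simp [hS]⟩ := by
      rw [← Finset.orderEmbOfFin_zero rfl h0]
      simp [t]
    rw [this]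
    exact le_antisymm (Finset.min'_le _ _ (by simp [hS])) zero_le
  have he : e = ∑ j ∈ Finset.range S.card, Finsupp.single (t j) (e (t j)) := by
    conv_lhs => rw [← Finsupp.sum_single e]
    rw [Finsupp.sum_of_support_subset e (Finset.subset_insert 0 _) _ (by simp), ← hS,
      Finset.sum_range]
    conv_lhs => rw [← Finset.map_orderEmbOfFin_univ S rfl]
    rw [Finset.sum_map]
    refine Finset.sum_congr rfl fun i _ => ?_
    have : t i = S.orderEmbOfFin rfl i := by
      simp only [t]
      congr 2
      omega
    rw [this]
    rfl
  refine ⟨S.card, t, fun k => ∑ j ∈ Finset.Ioo k S.card, e (t j),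
    ∑ j ∈ Finset.range S.card, e (t j), ht, ?_⟩
  have key (j : ℕ) (c : E) : Finsupp.single (t j) c = Finsupp.single 0 c +
      ∑ k ∈ Finset.range j, (Finsupp.single (t (k + 1)) c - Finsupp.single (t k) c) := by
    rw [Finset.sum_range_sub (fun k => Finsupp.single (t k) c), ht0]
    abel
  conv_lhs => rw [he]
  simp_rw [Finsupp.single_finsetSum, ← Finset.sum_sub_distrib]
  rw [Finset.sum_congr rfl fun j _ => key j _, Finset.sum_add_distrib]
  congr 1
  refine Finset.sum_comm' fun j k => ?_
  simp only [Finset.mem_range, Finset.mem_Ioo]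
  omega

end Step

/-! ### Characteristic functions of integrals of step functions. -/

section Levy
variable {d : ℕ} {Ω : Type*} [MeasurableSpace Ω] {P : Measure Ω} [IsProbabilityMeasure P]
  {Y : ℝ≥0 → Ω → EuclideanSpace ℝ (Fin d)} {ψ : EuclideanSpace ℝ (Fin d) → ℂ}

namespace IsLevyProcess

theorem integral_exp_sum_increments (hY : IsLevyProcess P Y) (hψ : IsCumulant (P.map (Y 1)) ψ)
    (n : ℕ) {t : ℕ → ℝ≥0} (ht : Monotone t) (w : ℕ → EuclideanSpace ℝ (Fin d)) :
    ∫ ω, Complex.exp ((∑ k ∈ Finset.range n, inner ℝ (w k) (Y (t (k + 1)) ω - Y (t k) ω) : ℝ) *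
      Complex.I) ∂P =
    Complex.exp (∑ k ∈ Finset.range n, ((t (k + 1) : ℝ) - t k : ℝ) * ψ (w k)) := by
  have hmeas (k : ℕ) : Measurable fun ω => (inner ℝ (w k) (Y (t (k + 1)) ω - Y (t k) ω) : ℝ) :=
    measurable_const.inner ((hY.measurable _).sub (hY.measurable _))
  have hind : iIndepFun (fun k ω => (inner ℝ (w k) (Y (t (k + 1)) ω - Y (t k) ω) : ℝ)) P :=
    (hY.indep.nat ht).comp (fun k x => (inner ℝ (w k) x : ℝ))
      fun k => measurable_const.inner measurable_id
  have h := congrFun ((hind.restrict (Finset.range n)).charFun_map_fun_finsetSum_eq_prod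
    fun k _ => (hmeas k).aemeasurable) 1
  rw [charFun_apply_real, integral_map (Finset.measurable_sum _ fun k _ => hmeas k).aemeasurable
    (by fun_prop)] at h
  simp only [Complex.ofReal_one, one_mul] at h
  rw [h, Complex.exp_sum, Finset.prod_apply]
  refine Finset.prod_congr rfl fun k _ => ?_
  have hinc : P.map (fun ω => Y (t (k + 1)) ω - Y (t k) ω) = P.map (Y (t (k + 1) - t k)) := by
    have := (hY.stationary (t k) (t (k + 1) - t k)).map_eq
    rw [add_tsub_cancel_of_le (ht (Nat.le_succ k))] at this
    exact this
  have := hY.charFun_eq hψ (t (k + 1) - t k) (w k)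
  rw [NNReal.coe_sub (ht (Nat.le_succ k)), ← hinc, charFun_apply,
    integral_map (f := fun x => Complex.exp ((inner ℝ x (w k) : ℝ) * Complex.I))
      (φ := fun ω => Y (t (k + 1)) ω - Y (t k) ω)
      ((hY.measurable _).sub (hY.measurable _)).aemeasurable (by fun_prop)] at this
  rw [← this, charFun_apply_real, integral_map (hmeas k).aemeasurable (by fun_prop)]
  simp_rw [real_inner_comm]
  simp

/-- On disjoint cells ψ commutes with the sum, so the integral of ψ is the exponent produced by
independent increments. The jump at time 0 affects neither side: Y_0 = 0 almost surely, and {0} is a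
null set. -/
theorem integral_exp_stepIntegral (hY : IsLevyProcess P Y) (hψ : IsCumulant (P.map (Y 1)) ψ)
    (e : ℝ≥0 →₀ EuclideanSpace ℝ (Fin d)) :
    ∫ ω, Complex.exp (stepIntegral Y e ω * Complex.I) ∂P =
      Complex.exp (∫ s, ψ (stepFun e s) ∂lebesgueNNReal) := by
  obtain ⟨n, t, w, c, ht, rfl⟩ := exists_eq_sum_single_sub_single e
  have hI : stepIntegral Y (Finsupp.single 0 c + ∑ k ∈ Finset.range n,
      (Finsupp.single (t (k + 1)) (w k) - Finsupp.single (t k) (w k))) =ᵐ[P]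
      fun ω => ∑ k ∈ Finset.range n, inner ℝ (w k) (Y (t (k + 1)) ω - Y (t k) ω) := by
    filter_upwards [hY.zero] with ω hω
    rw [map_add, map_sum, Pi.add_apply, Finset.sum_apply, stepIntegral_single]
    simp only [hω, stepIntegral_single_sub_single, inner_zero_right, zero_add]
  have hdisj : ((Finset.range n : Finset ℕ) : Set ℕ).PairwiseDisjoint
      fun k => Set.Ioc (t k) (t (k + 1)) := by
    have := ht.pairwise_disjoint_on_Ioc_succ
    exact fun i _ j _ hij => this hij
  have hF : (fun s => ψ (stepFun (Finsupp.single 0 c + ∑ k ∈ Finset.range n,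
      (Finsupp.single (t (k + 1)) (w k) - Finsupp.single (t k) (w k))) s)) =ᵐ[lebesgueNNReal]
      fun s => ∑ k ∈ Finset.range n,
        (Set.Ioc (t k) (t (k + 1))).indicator (fun _ => ψ (w k)) s := by
    have : ∀ᵐ s ∂lebesgueNNReal, s ≠ 0 := by
      rw [ae_iff]
      simpa using lebesgueNNReal_singleton 0
    filter_upwards [this] with s hs
    rw [map_add, map_sum, Pi.add_apply, Finset.sum_apply, stepFun_single,
      ← comp_sum_indicator_of_pairwiseDisjoint hψ.2.1 _ _ hdisj]
    simp only [stepFun_single_sub_single (ht (Nat.le_succ _))]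
    simp [hs]
  rw [integral_congr_ae (hI.mono fun ω hω => by simp only [hω]; rfl),
    hY.integral_exp_sum_increments hψ n ht w, integral_congr_ae hF, integral_finsetSum]
  · congr 1
    refine Finset.sum_congr rfl fun k _ => ?_
    rw [integral_indicator_const _ measurableSet_Ioc, measureReal_def, lebesgueNNReal_Ioc,
      ENNReal.toReal_ofReal (sub_nonneg.2 (by exact_mod_cast ht (Nat.le_succ k)))]
    simp
  · intro k _
    rw [integrable_indicator_iff measurableSet_Ioc]
    refine integrableOn_const ?_
    rw [lebesgueNNReal_Ioc]
    simp

end IsLevyProcess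
end Levy

end

/-! ### Bounded functions of bounded support and their bounded convergence. -/

noncomputable section

section Bounded

variable {ι κ E F : Type*} [NormedAddCommGroup E] [NormedSpace ℝ E] [NormedAddCommGroup F]

/-- Bounded measurable functions with bounded support. -/
structure IsBddSupp [MeasurableSpace E] (h : ℝ≥0 → E) : Prop where
  measurable : Measurable h
  bounded : ∃ C : ℝ, ∀ s, ‖h s‖ ≤ C
  support : ∃ N : ℝ≥0, ∀ s, N < s → h s = 0

/-- Almost everywhere convergence of uniformly bounded functions supported in a common bounded
set. -/
structure TendstoBoundedly (F : ι → ℝ≥0 → E) (l : Filter ι) (h : ℝ≥0 → E) : Prop where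
  bounded : ∃ C : ℝ, ∀ i s, ‖F i s‖ ≤ C
  support : ∃ N : ℝ≥0, ∀ i s, N < s → F i s = 0
  tendsto : ∀ᵐ s ∂lebesgueNNReal, Tendsto (fun i => F i s) l (𝓝 (h s))

namespace IsBddSupp

variable [MeasurableSpace E] [BorelSpace E] [SecondCountableTopology E] {h h' : ℝ≥0 → E}

theorem add (hh : IsBddSupp h) (hh' : IsBddSupp h') : IsBddSupp (fun s => h s + h' s) := by
  obtain ⟨C, hC⟩ := hh.bounded
  obtain ⟨C', hC'⟩ := hh'.bounded
  obtain ⟨N, hN⟩ := hh.support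
  obtain ⟨N', hN'⟩ := hh'.support
  refine ⟨hh.measurable.add hh'.measurable, ⟨C + C', fun s => ?_⟩, max N N', fun s hs => ?_⟩
  · exact (norm_add_le _ _).trans (add_le_add (hC s) (hC' s))
  · rw [hN s ((le_max_left _ _).trans_lt hs), hN' s ((le_max_right _ _).trans_lt hs), add_zero]

theorem const_smul (c : ℝ) (hh : IsBddSupp h) : IsBddSupp (fun s => c • h s) := by
  obtain ⟨C, hC⟩ := hh.bounded
  obtain ⟨N, hN⟩ := hh.support
  refine ⟨hh.measurable.const_smul c, ⟨‖c‖ * C, fun s => ?_⟩, N, fun s hs => ?_⟩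
  · rw [norm_smul]
    exact mul_le_mul_of_nonneg_left (hC s) (norm_nonneg _)
  · rw [hN s hs, smul_zero]

variable (E) in
/-- The space of bounded measurable functions with bounded support. -/
def submodule : Submodule ℝ (ℝ≥0 → E) where
  carrier := {h | IsBddSupp h}
  zero_mem' := ⟨measurable_const, ⟨0, by simp⟩, 0, by simp⟩
  add_mem' := fun h h' => add h h'
  smul_mem' := fun c _ h => const_smul c h

theorem mem_submodule : h ∈ submodule E ↔ IsBddSupp h := Iff.rfl

theorem sub (hh : IsBddSupp h) (hh' : IsBddSupp h') : IsBddSupp (fun s => h s - h' s) :=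
  (submodule E).sub_mem hh hh'

theorem finsetSum {s : Finset κ} {h : κ → ℝ≥0 → E} (hh : ∀ k ∈ s, IsBddSupp (h k)) :
    IsBddSupp (fun x => ∑ k ∈ s, h k x) := by
  have := (submodule E).sum_mem hh
  rw [mem_submodule] at this
  convert this using 2
  simp

theorem smul_const {f : ℝ≥0 → ℝ} (hf : IsBddSupp f) (z : E) : IsBddSupp (fun s => f s • z) := by
  obtain ⟨C, hC⟩ := hf.bounded
  obtain ⟨N, hN⟩ := hf.support
  refine ⟨hf.measurable.smul_const z, ⟨C * ‖z‖, fun s => ?_⟩, N, fun s hs => ?_⟩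
  · rw [norm_smul]
    exact mul_le_mul_of_nonneg_right (hC s) (norm_nonneg _)
  · rw [hN s hs, zero_smul]

end IsBddSupp

namespace TendstoBoundedly

variable {l : Filter ι} {f f' : ι → ℝ≥0 → E} {h h' : ℝ≥0 → E}

theorem add (hf : TendstoBoundedly f l h) (hf' : TendstoBoundedly f' l h') :
    TendstoBoundedly (fun i s => f i s + f' i s) l (fun s => h s + h' s) := by
  obtain ⟨C, hC⟩ := hf.bounded
  obtain ⟨C', hC'⟩ := hf'.bounded
  obtain ⟨N, hN⟩ := hf.support
  obtain ⟨N', hN'⟩ := hf'.support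
  refine ⟨⟨C + C', fun i s => ?_⟩, ⟨max N N', fun i s hs => ?_⟩, ?_⟩
  · exact (norm_add_le _ _).trans (add_le_add (hC i s) (hC' i s))
  · rw [hN i s ((le_max_left _ _).trans_lt hs), hN' i s ((le_max_right _ _).trans_lt hs), add_zero]
  · filter_upwards [hf.tendsto, hf'.tendsto] with s h1 h2 using h1.add h2

theorem const_smul (c : ℝ) (hf : TendstoBoundedly f l h) :
    TendstoBoundedly (fun i s => c • f i s) l (fun s => c • h s) := by
  obtain ⟨C, hC⟩ := hf.bounded
  obtain ⟨N, hN⟩ := hf.support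
  refine ⟨⟨‖c‖ * C, fun i s => ?_⟩, ⟨N, fun i s hs => ?_⟩, ?_⟩
  · rw [norm_smul]
    exact mul_le_mul_of_nonneg_left (hC i s) (norm_nonneg _)
  · rw [hN i s hs, smul_zero]
  · filter_upwards [hf.tendsto] with s h1 using h1.const_smul c

theorem sub (hf : TendstoBoundedly f l h) (hf' : TendstoBoundedly f' l h') :
    TendstoBoundedly (fun i s => f i s - f' i s) l (fun s => h s - h' s) := by
  simpa only [sub_eq_add_neg, neg_one_smul] using hf.add (hf'.const_smul (-1))

theorem smul_const {f : ι → ℝ≥0 → ℝ} {h : ℝ≥0 → ℝ} (hf : TendstoBoundedly f l h) (z : E) :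
    TendstoBoundedly (fun i s => f i s • z) l (fun s => h s • z) := by
  obtain ⟨C, hC⟩ := hf.bounded
  obtain ⟨N, hN⟩ := hf.support
  refine ⟨⟨C * ‖z‖, fun i s => ?_⟩, ⟨N, fun i s hs => ?_⟩, ?_⟩
  · rw [norm_smul]
    exact mul_le_mul_of_nonneg_right (hC i s) (norm_nonneg _)
  · rw [hN i s hs, zero_smul]
  · filter_upwards [hf.tendsto] with s h1 using h1.smul_const z

theorem comp {l' : Filter κ} {φ : κ → ι} (hf : TendstoBoundedly f l h) (hφ : Tendsto φ l' l) :
    TendstoBoundedly (fun k => f (φ k)) l' h := by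
  obtain ⟨C, hC⟩ := hf.bounded
  obtain ⟨N, hN⟩ := hf.support
  exact ⟨⟨C, fun i s => hC _ s⟩, ⟨N, fun i s hs => hN _ s hs⟩,
    hf.tendsto.mono fun s hs => hs.comp hφ⟩

theorem const [MeasurableSpace E] (hh : IsBddSupp h) : TendstoBoundedly (fun _ : ι => h) l h := by
  obtain ⟨C, hC⟩ := hh.bounded
  obtain ⟨N, hN⟩ := hh.support
  exact ⟨⟨C, fun _ => hC⟩, ⟨N, fun _ => hN⟩, Eventually.of_forall fun s => tendsto_const_nhds⟩

theorem isBddSupp [MeasurableSpace E] (hf : TendstoBoundedly f l h) {i : ι}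
    (hm : Measurable (f i)) : IsBddSupp (f i) := by
  obtain ⟨C, hC⟩ := hf.bounded
  obtain ⟨N, hN⟩ := hf.support
  exact ⟨hm, ⟨C, hC i⟩, N, hN i⟩

/-- Dominated convergence: ψ is bounded on the closed ball that contains all values, and ψ(0) = 0
confines the integrands to a bounded interval. -/
theorem tendsto_integral_comp [MeasurableSpace E] [BorelSpace E] [ProperSpace E]
    [l.IsCountablyGenerated] (hf : TendstoBoundedly f l h) (hm : ∀ i, Measurable (f i)) {ψ : E → ℂ}
    (hψ : Continuous ψ) (hψ0 : ψ 0 = 0) :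
    Tendsto (fun i => ∫ s, ψ (f i s) ∂lebesgueNNReal) l (𝓝 (∫ s, ψ (h s) ∂lebesgueNNReal)) := by
  obtain ⟨C, hC⟩ := hf.bounded
  obtain ⟨N, hN⟩ := hf.support
  obtain ⟨K, hK⟩ := (isCompact_closedBall (0 : E) C).exists_bound_of_continuousOn hψ.continuousOn
  refine tendsto_integral_filter_of_dominated_convergence ((Set.Iic N).indicator fun _ => K)
    (Eventually.of_forall fun i => (hψ.measurable.comp (hm i)).aestronglyMeasurable)
    (Eventually.of_forall fun i => Eventually.of_forall fun s => ?_) ?_ ?_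
  · by_cases hs : s ≤ N
    · simpa [hs] using hK (f i s) (by simpa using hC i s)
    · simp [hN i s (not_le.1 hs), hψ0, hs]
  · rw [integrable_indicator_iff measurableSet_Iic]
    exact integrableOn_const (lebesgueNNReal_Iic_lt_top N).ne
  · filter_upwards [hf.tendsto] with s hs using (hψ.tendsto _).comp hs

end TendstoBoundedly

theorem norm_setAverage_le_of_norm_le [CompleteSpace E] {X : Type*} [MeasurableSpace X]
    {μ : Measure X} {A : Set X} (hA : μ A ≠ ∞)
    {f : X → E} {C : ℝ} (hC0 : 0 ≤ C) (hC : ∀ x, ‖f x‖ ≤ C) : ‖⨍ x in A, f x ∂μ‖ ≤ C := by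
  rw [setAverage_eq, norm_smul]
  have h := norm_setIntegral_le_of_norm_le_const (lt_top_iff_ne_top.2 hA) fun x _ => hC x
  rcases eq_or_ne (μ.real A) 0 with h0 | h0
  · simpa [h0] using hC0
  · have hpos : 0 < μ.real A := lt_of_le_of_ne measureReal_nonneg (Ne.symm h0)
    rw [norm_inv, Real.norm_of_nonneg hpos.le, inv_mul_le_iff₀ hpos, mul_comm]
    exact h

end Bounded

/-! ### Approximation by step functions through Lebesgue differentiation. -/

section Approximation

variable {E : Type*} [NormedAddCommGroup E] [InnerProductSpace ℝ E] [CompleteSpace E]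
  [MeasurableSpace E] [BorelSpace E] [SecondCountableTopology E]

/-- Every bounded measurable function with bounded support is a bounded almost everywhere limit of
step functions, namely of its averages over the cells of a regular grid. -/
theorem IsBddSupp.exists_tendstoBoundedly_stepFun {h : ℝ≥0 → E} (hh : IsBddSupp h) :
    ∃ e : ℕ → ℝ≥0 →₀ E, TendstoBoundedly (fun n => stepFun (e n)) atTop h := by
  obtain ⟨C, hC⟩ := hh.bounded
  obtain ⟨N', hN'⟩ := hh.support
  obtain ⟨N, hN⟩ : ∃ N : ℕ, ∀ s : ℝ≥0, (N : ℝ≥0) < s → h s = 0 := by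
    obtain ⟨N, hN⟩ := exists_nat_ge N'
    exact ⟨N, fun s hs => hN' s (hN.trans_lt hs)⟩
  have hC0 : 0 ≤ C := (norm_nonneg _).trans (hC 0)
  -- The extension to ℝ is constant on the negative axis; local integrability is all that
  -- differentiation requires.
  let H : ℝ → E := fun x => h x.toNNReal
  have hH : LocallyIntegrable H volume := by
    have : MemLp H ⊤ volume := memLp_top_of_bound
      (hh.measurable.comp measurable_real_toNNReal).aestronglyMeasurable C
      (Eventually.of_forall fun x => hC _)
    exact this.locallyIntegrable le_top
  let p : ℕ → ℕ → ℝ≥0 := fun n k => k / (n + 1)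
  have hp (n : ℕ) : Monotone (p n) := fun i j hij => by
    simp only [p]
    gcongr
  -- With half the mesh as radius and cell midpoints as centres, each closed ball is the closure of
  -- a grid cell.
  let δ : ℕ → ℝ := fun n => (2 * (n + 1))⁻¹
  let w : ℕ → ℕ → ℝ := fun n k => (k + 1 / 2) / (n + 1)
  let A : ℕ → ℕ → E := fun n k => ⨍ y in Metric.closedBall (w n k) (δ n), H y
  let e : ℕ → ℝ≥0 →₀ E := fun n => ∑ k ∈ Finset.range (N * (n + 1)),
    (Finsupp.single (p n (k + 1)) (A n k) - Finsupp.single (p n k) (A n k))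
  have he (n : ℕ) (s : ℝ≥0) : stepFun (e n) s = ∑ k ∈ Finset.range (N * (n + 1)),
      (Set.Ioc (p n k) (p n (k + 1))).indicator (fun _ => A n k) s := by
    simp only [e, map_sum, Finset.sum_apply, stepFun_single_sub_single (hp n (Nat.le_succ _))]
  have hdisj (n : ℕ) : ((Finset.range (N * (n + 1)) : Finset ℕ) : Set ℕ).PairwiseDisjoint
      fun k => Set.Ioc (p n k) (p n (k + 1)) := fun i _ j _ hij =>
    (hp n).pairwise_disjoint_on_Ioc_succ hij
  have hA (n k : ℕ) : ‖A n k‖ ≤ C :=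
    norm_setAverage_le_of_norm_le measure_closedBall_lt_top.ne hC0 fun x => hC _
  refine ⟨e, ⟨C, fun n s => ?_⟩, ⟨N, fun n s hs => ?_⟩, ?_⟩
  · rw [he]
    by_cases hs : ∃ k ∈ Finset.range (N * (n + 1)), s ∈ Set.Ioc (p n k) (p n (k + 1))
    · obtain ⟨k, hk, hks⟩ := hs
      rw [sum_indicator_eq_of_pairwiseDisjoint (hdisj n) _ hk hks]
      exact hA n k
    · push Not at hs
      rw [sum_indicator_eq_zero _ hs]
      simpa using hC0
  · rw [he]
    refine sum_indicator_eq_zero _ fun k hk hks => ?_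
    refine absurd (hks.2.trans ?_) (not_le.2 hs)
    simp only [p]
    rw [div_le_iff₀ (by positivity)]
    have := Finset.mem_range.1 hk
    exact_mod_cast this
  · have hleb := IsUnifLocDoublingMeasure.ae_tendsto_average volume hH 1
    have hleb' := ae_of_ae_map measurableEmbedding_nnreal_coe.measurable.aemeasurable
      ((map_coe_lebesgueNNReal ▸ Measure.restrict_le_self.absolutelyContinuous).ae_le hleb)
    have h0 : ∀ᵐ s ∂lebesgueNNReal, s ≠ 0 := by
      rw [ae_iff]
      simpa using lebesgueNNReal_singleton 0
    filter_upwards [hleb', h0] with s hs hs0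
    by_cases hsN : s ≤ N
    · have hcell (n : ℕ) : ∃ k ∈ Finset.range (N * (n + 1)), s ∈ Set.Ioc (p n k) (p n (k + 1)) := by
        have hpos : 0 < s * (n + 1) := by positivity
        have hc : 0 < ⌈s * (n + 1)⌉₊ := Nat.ceil_pos.2 hpos
        have hc1 : ((⌈s * (n + 1)⌉₊ - 1 : ℕ) : ℝ≥0) + 1 = ⌈s * (n + 1)⌉₊ := by
          exact_mod_cast Nat.sub_add_cancel hc
        -- Cells are open on the left, so the index is the ceiling minus one; s ≠ 0 keeps the
        -- subtraction from truncating.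
        refine ⟨⌈s * (n + 1)⌉₊ - 1, ?_, ?_, ?_⟩
        · have : ⌈s * (n + 1)⌉₊ ≤ N * (n + 1) := by
            rw [Nat.ceil_le]
            push_cast
            gcongr
          rw [Finset.mem_range]
          omega
        · simp only [p]
          rw [div_lt_iff₀ (by positivity)]
          have := Nat.ceil_lt_add_one hpos.le
          rw [← hc1] at this
          exact lt_of_add_lt_add_right this
        · simp only [p]
          rw [le_div_iff₀ (by positivity)]
          rw [Nat.cast_add_one, hc1]
          exact Nat.le_ceil _
      choose k hk hks using hcell
      have hval (n : ℕ) : stepFun (e n) s = A n (k n) := by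
        rw [he, sum_indicator_eq_of_pairwiseDisjoint (hdisj n) _ (hk n) (hks n)]
      simp only [hval]
      have hδ : Tendsto δ atTop (𝓝[>] 0) := by
        refine tendsto_nhdsWithin_iff.2 ⟨?_, Eventually.of_forall fun n => ?_⟩
        · refine tendsto_inv_atTop_zero.comp (Tendsto.const_mul_atTop (by norm_num) ?_)
          exact tendsto_atTop_add_const_right _ _ tendsto_natCast_atTop_atTop
        · simp only [δ, Set.mem_Ioi]
          positivity
      have := hs (fun n => w n (k n)) δ hδ (Eventually.of_forall fun n => ?_)
      · simpa [H] using this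
      · have h1 : ((k n : ℝ)) / (n + 1) < s := by
          simpa [p] using NNReal.coe_lt_coe.2 (hks n).1
        have h2 : (s : ℝ) ≤ ((k n : ℝ) + 1) / (n + 1) := by
          simpa [p] using NNReal.coe_le_coe.2 (hks n).2
        rw [Metric.mem_closedBall, Real.dist_eq, abs_le]
        have hn : (0 : ℝ) < n + 1 := by positivity
        have e1 : w n (k n) = (k n : ℝ) / (n + 1) + δ n := by
          simp only [w, δ]
          field_simp
        have e2 : ((k n : ℝ) + 1) / (n + 1) = (k n : ℝ) / (n + 1) + 2 * δ n := by
          simp only [δ]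
          field_simp
        constructor <;> linarith
    · have hval (n : ℕ) : stepFun (e n) s = 0 := by
        rw [he]
        refine sum_indicator_eq_zero _ fun k hk hks => hsN (hks.2.trans ?_)
        simp only [p]
        rw [div_le_iff₀ (by positivity)]
        have := Finset.mem_range.1 hk
        exact_mod_cast this
      simp only [hval, hN s (not_le.1 hsN)]
      exact tendsto_const_nhds

end Approximation

end

/-! ### The scalar integral of vector-valued functions. -/

noncomputable section

section LevyIntegral

variable {d : ℕ} {Ω ι : Type*} [MeasurableSpace Ω] {P : Measure Ω}
  {Y : ℝ≥0 → Ω → EuclideanSpace ℝ (Fin d)} {ψ : EuclideanSpace ℝ (Fin d) → ℂ} {l : Filter ι}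

open Classical in
variable (P Y) in
/-- The integral `∫ ⟨h(s), dY_s⟩` as a limit in probability of integrals of step functions. -/
def levyIntegral (h : ℝ≥0 → EuclideanSpace ℝ (Fin d)) : Ω → ℝ :=
  if H : ∃ W : Ω → ℝ, Measurable W ∧ ∃ e : ℕ → ℝ≥0 →₀ EuclideanSpace ℝ (Fin d),
      TendstoBoundedly (fun n => stepFun (e n)) atTop h ∧
      TendstoInMeasure P (fun n => stepIntegral Y (e n)) atTop W
  then H.choose else 0

theorem measurable_levyIntegral (h : ℝ≥0 → EuclideanSpace ℝ (Fin d)) :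
    Measurable (levyIntegral P Y h) := by
  unfold levyIntegral
  split_ifs with H
  · exact H.choose_spec.1
  · exact measurable_const

namespace IsLevyProcess

variable [IsProbabilityMeasure P] (hY : IsLevyProcess P Y) (hψ : IsCumulant (P.map (Y 1)) ψ)
include hY hψ

/-- By linearity the characteristic function at u is the exponential formula for the u-multiple of
the step function, and its exponent tends to 0. Allowing any countably generated filter makes this
usable for double sequences. -/
theorem tendsto_stepIntegral_zero [l.IsCountablyGenerated]
    {e : ι → ℝ≥0 →₀ EuclideanSpace ℝ (Fin d)}
    (he : TendstoBoundedly (fun i => stepFun (e i)) l (fun _ => 0)) :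
    TendstoInMeasure P (fun i => stepIntegral Y (e i)) l 0 := by
  refine tendstoInMeasure_zero_of_tendsto_integral_exp
    (fun i => (measurable_stepIntegral hY.measurable _).aemeasurable) fun u => ?_
  have h1 := (he.const_smul u).tendsto_integral_comp
    (fun i => (measurable_stepFun (e i)).const_smul u) hψ.1 hψ.2.1
  simp only [smul_zero, hψ.2.1, integral_zero] at h1
  have h2 := (Complex.continuous_exp.tendsto 0).comp h1
  rw [Complex.exp_zero] at h2
  refine h2.congr fun i => ?_
  have := hY.integral_exp_stepIntegral hψ (u • e i)
  rw [map_smul, map_smul] at this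
  simpa using this.symm

/-- The limit does not depend on the approximating sequence: two such sequences differ by step
functions tending boundedly to 0. The same estimate on pairs gives the Cauchy property, hence
existence. -/
theorem tendsto_levyIntegral {h : ℝ≥0 → EuclideanSpace ℝ (Fin d)}
    {e : ℕ → ℝ≥0 →₀ EuclideanSpace ℝ (Fin d)}
    (he : TendstoBoundedly (fun n => stepFun (e n)) atTop h) :
    TendstoInMeasure P (fun n => stepIntegral Y (e n)) atTop (levyIntegral P Y h) := by
  have hm (n : ℕ) := measurable_stepIntegral hY.measurable (e n)
  have hc : TendstoInMeasure P (fun (p : ℕ × ℕ) ω =>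
      stepIntegral Y (e p.1) ω - stepIntegral Y (e p.2) ω) (atTop ×ˢ atTop) 0 := by
    have h1 := (he.comp tendsto_fst).sub (he.comp (tendsto_snd (f := (atTop : Filter ℕ))))
    simp only [sub_self] at h1
    have h2 := hY.tendsto_stepIntegral_zero hψ (l := (atTop : Filter ℕ) ×ˢ (atTop : Filter ℕ))
      (e := fun p => e p.1 - e p.2) (by simp only [map_sub]; exact h1)
    simp only [map_sub] at h2
    exact h2
  have H : ∃ W : Ω → ℝ, Measurable W ∧ ∃ e : ℕ → ℝ≥0 →₀ EuclideanSpace ℝ (Fin d),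
      TendstoBoundedly (fun n => stepFun (e n)) atTop h ∧
      TendstoInMeasure P (fun n => stepIntegral Y (e n)) atTop W := by
    obtain ⟨W, hW, hW'⟩ := exists_tendstoInMeasure_of_cauchy
      (fun n => (hm n).aestronglyMeasurable) hc
    exact ⟨W, hW.measurable, e, he, hW'⟩
  have hdef : levyIntegral P Y h = H.choose := dif_pos H
  obtain ⟨e', he', hW⟩ := H.choose_spec.2
  rw [← hdef] at hW
  have h1 := he.sub he'
  simp only [sub_self] at h1
  have h2 := hY.tendsto_stepIntegral_zero hψ (e := fun n => e n - e' n)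
    (by simp only [map_sub]; exact h1)
  simpa [map_sub] using h2.add hW

theorem levyIntegral_stepFun (e : ℝ≥0 →₀ EuclideanSpace ℝ (Fin d))
    (he : IsBddSupp (stepFun e)) : levyIntegral P Y (stepFun e) =ᵐ[P] stepIntegral Y e :=
  tendstoInMeasure_ae_unique
    (hY.tendsto_levyIntegral hψ (e := fun _ => e) (TendstoBoundedly.const he))
    (TendstoInMeasure.const _)

theorem levyIntegral_add {h h' : ℝ≥0 → EuclideanSpace ℝ (Fin d)} (hh : IsBddSupp h)
    (hh' : IsBddSupp h') : levyIntegral P Y (fun s => h s + h' s) =ᵐ[P]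
      fun ω => levyIntegral P Y h ω + levyIntegral P Y h' ω := by
  obtain ⟨e, he⟩ := hh.exists_tendstoBoundedly_stepFun
  obtain ⟨e', he'⟩ := hh'.exists_tendstoBoundedly_stepFun
  refine tendstoInMeasure_ae_unique (hY.tendsto_levyIntegral hψ (e := fun n => e n + e' n) ?_) ?_
  · simp only [map_add]
    exact he.add he'
  · simp only [map_add]
    exact (hY.tendsto_levyIntegral hψ he).add (hY.tendsto_levyIntegral hψ he')

theorem levyIntegral_smul {h : ℝ≥0 → EuclideanSpace ℝ (Fin d)} (hh : IsBddSupp h) (c : ℝ) :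
    levyIntegral P Y (fun s => c • h s) =ᵐ[P] fun ω => c * levyIntegral P Y h ω := by
  obtain ⟨e, he⟩ := hh.exists_tendstoBoundedly_stepFun
  refine tendstoInMeasure_ae_unique (hY.tendsto_levyIntegral hψ (e := fun n => c • e n) ?_) ?_
  · simp only [map_smul]
    exact he.const_smul c
  · simp only [map_smul]
    exact (hY.tendsto_levyIntegral hψ he).const_smul c

theorem levyIntegral_sub {h h' : ℝ≥0 → EuclideanSpace ℝ (Fin d)} (hh : IsBddSupp h)
    (hh' : IsBddSupp h') : levyIntegral P Y (fun s => h s - h' s) =ᵐ[P]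
      fun ω => levyIntegral P Y h ω - levyIntegral P Y h' ω := by
  filter_upwards [hY.levyIntegral_add hψ hh (hh'.const_smul (-1)),
    hY.levyIntegral_smul hψ hh' (-1)] with ω h1 h2
  rw [h2] at h1
  simpa only [neg_one_smul, ← sub_eq_add_neg, neg_one_mul] using h1

theorem levyIntegral_zero : levyIntegral P Y (fun _ => 0) =ᵐ[P] fun _ => 0 := by
  have := hY.levyIntegral_smul hψ (h := fun _ => 0) (IsBddSupp.submodule _).zero_mem 0
  simpa using this

theorem levyIntegral_finsetSum {κ : Type*} (s : Finset κ)
    {h : κ → ℝ≥0 → EuclideanSpace ℝ (Fin d)} (hh : ∀ k ∈ s, IsBddSupp (h k)) :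
    levyIntegral P Y (fun x => ∑ k ∈ s, h k x) =ᵐ[P]
      fun ω => ∑ k ∈ s, levyIntegral P Y (h k) ω := by
  classical
  induction s using Finset.induction_on with
  | empty => simpa using hY.levyIntegral_zero hψ
  | insert a s ha ih =>
    simp only [Finset.sum_insert ha]
    have hs : ∀ k ∈ s, IsBddSupp (h k) := fun k hk => hh k (by simp [hk])
    filter_upwards [ih hs, hY.levyIntegral_add hψ (hh a (by simp)) (IsBddSupp.finsetSum hs)]
      with ω h1 h2
    rw [h2, h1]

theorem integral_exp_levyIntegral {h : ℝ≥0 → EuclideanSpace ℝ (Fin d)} (hh : IsBddSupp h) :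
    ∫ ω, Complex.exp (levyIntegral P Y h ω * Complex.I) ∂P =
      Complex.exp (∫ s, ψ (h s) ∂lebesgueNNReal) := by
  obtain ⟨e, he⟩ := hh.exists_tendstoBoundedly_stepFun
  have h1 := tendsto_integral_exp_of_tendstoInMeasure
    (fun n => (measurable_stepIntegral hY.measurable (e n)).aemeasurable)
    (measurable_levyIntegral h).aemeasurable (hY.tendsto_levyIntegral hψ he)
  simp_rw [hY.integral_exp_stepIntegral hψ] at h1
  exact tendsto_nhds_unique h1 ((Complex.continuous_exp.tendsto _).comp
    (he.tendsto_integral_comp (fun n => measurable_stepFun _) hψ.1 hψ.2.1))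

/-- No common bound or support is assumed; only the exponents must vanish. This serves the limit t →
∞, where the supports grow. -/
theorem tendstoInMeasure_levyIntegral_zero_of_tendsto {h : ι → ℝ≥0 → EuclideanSpace ℝ (Fin d)}
    [l.IsCountablyGenerated] (hh : ∀ i, IsBddSupp (h i))
    (hlim : ∀ u : ℝ, Tendsto (fun i => ∫ s, ψ (u • h i s) ∂lebesgueNNReal) l (𝓝 0)) :
    TendstoInMeasure P (fun i => levyIntegral P Y (h i)) l 0 := by
  refine tendstoInMeasure_zero_of_tendsto_integral_exp
    (fun i => (measurable_levyIntegral _).aemeasurable) fun u => ?_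
  have h2 := (Complex.continuous_exp.tendsto 0).comp (hlim u)
  rw [Complex.exp_zero] at h2
  refine h2.congr fun i => ?_
  rw [Function.comp_apply, ← hY.integral_exp_levyIntegral hψ ((hh i).const_smul u)]
  refine integral_congr_ae ?_
  filter_upwards [hY.levyIntegral_smul hψ (hh i) u] with ω hω
  rw [hω]

theorem tendstoInMeasure_levyIntegral [l.IsCountablyGenerated]
    {f : ι → ℝ≥0 → EuclideanSpace ℝ (Fin d)} {h : ℝ≥0 → EuclideanSpace ℝ (Fin d)}
    (hf : TendstoBoundedly f l h) (hm : ∀ i, Measurable (f i)) (hh : IsBddSupp h) :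
    TendstoInMeasure P (fun i => levyIntegral P Y (f i)) l (levyIntegral P Y h) := by
  refine TendstoInMeasure.of_sub ?_
  refine (hY.tendstoInMeasure_levyIntegral_zero_of_tendsto hψ
    (h := fun i s => f i s - h s) (l := l) (fun i => (hf.isBddSupp (hm i)).sub hh)
    fun u => ?_).congr_left fun i => hY.levyIntegral_sub hψ (hf.isBddSupp (hm i)) hh
  have := ((hf.sub (TendstoBoundedly.const hh)).const_smul u).tendsto_integral_comp
    (fun i => ((hm i).sub hh.measurable).const_smul u) hψ.1 hψ.2.1
  simpa [hψ.2.1] using this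

end IsLevyProcess
end LevyIntegral

/-! ### The vector integral of scalar functions. -/

section VectorIntegral

variable {d : ℕ} {Ω ι : Type*} [MeasurableSpace Ω] {P : Measure Ω}
  {Y : ℝ≥0 → Ω → EuclideanSpace ℝ (Fin d)} {ψ : EuclideanSpace ℝ (Fin d) → ℂ} {l : Filter ι}

variable (P Y) in
/-- The vector-valued integral `∫ f(s) dY_s` of a scalar function. -/
def levyVecIntegral (f : ℝ≥0 → ℝ) (ω : Ω) : EuclideanSpace ℝ (Fin d) :=
  WithLp.toLp 2 fun j => levyIntegral P Y (fun s => f s • EuclideanSpace.single j (1 : ℝ)) ω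

theorem measurable_levyVecIntegral (f : ℝ≥0 → ℝ) : Measurable (levyVecIntegral P Y f) :=
  (WithLp.measurable_toLp 2 _).comp (measurable_pi_lambda _ fun _ => measurable_levyIntegral _)

namespace IsLevyProcess

variable [IsProbabilityMeasure P] (hY : IsLevyProcess P Y) (hψ : IsCumulant (P.map (Y 1)) ψ)
include hY hψ

theorem inner_levyVecIntegral {f : ℝ≥0 → ℝ} (hf : IsBddSupp f) (z : EuclideanSpace ℝ (Fin d)) :
    (fun ω => inner ℝ z (levyVecIntegral P Y f ω)) =ᵐ[P] levyIntegral P Y fun s => f s • z := by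
  have hz : (fun s => f s • z) = fun s => ∑ j, z j • f s • EuclideanSpace.single j (1 : ℝ) := by
    ext s i
    simp [Finset.sum_apply, Pi.single_apply, mul_comm]
  have h1 := hY.levyIntegral_finsetSum hψ Finset.univ
    fun j _ => ((hf.smul_const (EuclideanSpace.single j (1 : ℝ))).const_smul (z j))
  have h2 : ∀ᵐ ω ∂P, ∀ j, levyIntegral P Y (fun s => z j • f s • EuclideanSpace.single j (1 : ℝ)) ω
      = z j * levyIntegral P Y (fun s => f s • EuclideanSpace.single j (1 : ℝ)) ω :=
    ae_all_iff.2 fun j => hY.levyIntegral_smul hψ (hf.smul_const _) (z j)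
  filter_upwards [h1, h2] with ω h1 h2
  rw [hz, h1]
  simp only [h2]
  simp [PiLp.inner_apply, levyVecIntegral, mul_comm]

omit [IsProbabilityMeasure P] hY hψ in
theorem _root_.ae_eq_of_forall_inner_ae_eq {U V : Ω → EuclideanSpace ℝ (Fin d)}
    (h : ∀ z, (fun ω => inner ℝ z (U ω)) =ᵐ[P] fun ω => (inner ℝ z (V ω) : ℝ)) : U =ᵐ[P] V := by
  have : ∀ᵐ ω ∂P, ∀ j : Fin d, inner ℝ (EuclideanSpace.single j (1 : ℝ)) (U ω) =
      (inner ℝ (EuclideanSpace.single j (1 : ℝ)) (V ω) : ℝ) := ae_all_iff.2 fun j => h _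
  filter_upwards [this] with ω hω
  ext j
  simpa [EuclideanSpace.inner_single_left] using hω j

theorem levyVecIntegral_finsetSum {κ : Type*} (s : Finset κ) (c : κ → ℝ) {f : κ → ℝ≥0 → ℝ}
    (hf : ∀ k ∈ s, IsBddSupp (f k)) :
    levyVecIntegral P Y (fun x => ∑ k ∈ s, c k * f k x) =ᵐ[P]
      fun ω => ∑ k ∈ s, c k • levyVecIntegral P Y (f k) ω := by
  refine ae_eq_of_forall_inner_ae_eq fun z => ?_
  have hcf : ∀ k ∈ s, IsBddSupp fun x => c k * f k x := fun k hk => (hf k hk).const_smul (c k)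
  have h1 := hY.inner_levyVecIntegral hψ (IsBddSupp.finsetSum hcf) z
  have h2 := hY.levyIntegral_finsetSum hψ s fun k hk => ((hf k hk).smul_const z).const_smul (c k)
  have h3 : ∀ᵐ ω ∂P, ∀ k ∈ s, levyIntegral P Y (fun x => c k • f k x • z) ω =
      c k * levyIntegral P Y (fun x => f k x • z) ω := by
    refine (ae_ball_iff s.countable_toSet).2 fun k hk =>
      hY.levyIntegral_smul hψ ((hf k hk).smul_const z) (c k)
  have h4 : ∀ᵐ ω ∂P, ∀ k ∈ s, inner ℝ z (levyVecIntegral P Y (f k) ω) =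
      levyIntegral P Y (fun x => f k x • z) ω := by
    refine (ae_ball_iff s.countable_toSet).2 fun k hk => hY.inner_levyVecIntegral hψ (hf k hk) z
  filter_upwards [h1, h2, h3, h4] with ω h1 h2 h3 h4
  rw [h1, inner_sum]
  simp only [Finset.sum_smul, mul_smul]
  rw [h2]
  refine Finset.sum_congr rfl fun k hk => ?_
  rw [h3 k hk, inner_smul_right, h4 k hk]

/-- The joint characteristic function of finitely many integrals. -/
theorem integral_exp_sum_inner_levyVecIntegral {κ : Type*} (s : Finset κ) {f : κ → ℝ≥0 → ℝ}
    (hf : ∀ k ∈ s, IsBddSupp (f k)) (z : κ → EuclideanSpace ℝ (Fin d)) :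
    ∫ ω, Complex.exp ((∑ k ∈ s, inner ℝ (z k) (levyVecIntegral P Y (f k) ω) : ℝ) * Complex.I) ∂P =
      Complex.exp (∫ x, ψ (∑ k ∈ s, f k x • z k) ∂lebesgueNNReal) := by
  have hfz : ∀ k ∈ s, IsBddSupp fun x => f k x • z k := fun k hk => (hf k hk).smul_const (z k)
  rw [← hY.integral_exp_levyIntegral hψ (IsBddSupp.finsetSum hfz)]
  refine integral_congr_ae ?_
  have h4 : ∀ᵐ ω ∂P, ∀ k ∈ s, inner ℝ (z k) (levyVecIntegral P Y (f k) ω) =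
      levyIntegral P Y (fun x => f k x • z k) ω := by
    refine (ae_ball_iff s.countable_toSet).2 fun k hk => hY.inner_levyVecIntegral hψ (hf k hk) (z k)
  filter_upwards [h4, hY.levyIntegral_finsetSum hψ s hfz] with ω h4 h5
  rw [h5, Finset.sum_congr rfl h4]

theorem charFun_levyVecIntegral {f : ℝ≥0 → ℝ} (hf : IsBddSupp f) (z : EuclideanSpace ℝ (Fin d)) :
    charFun (P.map (levyVecIntegral P Y f)) z =
      Complex.exp (∫ x, ψ (f x • z) ∂lebesgueNNReal) := by
  have := hY.integral_exp_sum_inner_levyVecIntegral hψ {()} (f := fun _ => f) (fun _ _ => hf)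
    fun _ => z
  simp only [Finset.sum_singleton] at this
  rw [← this, charFun_apply, integral_map (measurable_levyVecIntegral f).aemeasurable (by fun_prop)]
  simp_rw [real_inner_comm]

theorem tendstoInMeasure_levyVecIntegral [l.IsCountablyGenerated] {f : ι → ℝ≥0 → ℝ} {h : ℝ≥0 → ℝ}
    (hf : TendstoBoundedly f l h) (hm : ∀ i, Measurable (f i)) (hh : IsBddSupp h) :
    TendstoInMeasure P (fun i => levyVecIntegral P Y (f i)) l (levyVecIntegral P Y h) :=
  TendstoInMeasure.euclidean fun _ => hY.tendstoInMeasure_levyIntegral hψ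
    (hf.smul_const _) (fun i => (hm i).smul_const _) (hh.smul_const _)

end IsLevyProcess
end VectorIntegral

end

/-! ### The induced random measure, local integrals and improper integrals. -/

noncomputable section

section RandomMeasure

variable {d : ℕ} {Ω ι : Type*} [MeasurableSpace Ω] {P : Measure Ω}
  {Y : ℝ≥0 → Ω → EuclideanSpace ℝ (Fin d)} {ψ : EuclideanSpace ℝ (Fin d) → ℂ} {l : Filter ι}

theorem tendsto_charFun_of_tendstoInMeasure [IsProbabilityMeasure P] [l.IsCountablyGenerated]
    {X : ι → Ω → EuclideanSpace ℝ (Fin d)} {Z : Ω → EuclideanSpace ℝ (Fin d)}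
    (hX : ∀ i, Measurable (X i)) (hZ : Measurable Z) (h : TendstoInMeasure P X l Z)
    (z : EuclideanSpace ℝ (Fin d)) :
    Tendsto (fun i => charFun (P.map (X i)) z) l (𝓝 (charFun (P.map Z) z)) := by
  have hchar (U : Ω → EuclideanSpace ℝ (Fin d)) (hU : Measurable U) : charFun (P.map U) z =
      ∫ ω, Complex.exp ((inner ℝ z (U ω) : ℝ) * Complex.I) ∂P := by
    rw [charFun_apply, integral_map hU.aemeasurable (by fun_prop)]
    simp_rw [real_inner_comm]
  simp_rw [hchar _ hZ, hchar _ (hX _)]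
  exact tendsto_integral_exp_of_tendstoInMeasure
    (fun i => (measurable_const.inner (hX i)).aemeasurable)
    (measurable_const.inner hZ).aemeasurable (h.lipschitz_comp (innerSL ℝ z).lipschitz)

theorem IsBddBorel.exists_le {B : Set ℝ≥0} (hB : IsBddBorel B) : ∃ N, ∀ s ∈ B, s ≤ N := by
  obtain ⟨r, hr⟩ := hB.2.subset_closedBall 0
  refine ⟨r.toNNReal, fun s hs => ?_⟩
  have := hr hs
  rw [Metric.mem_closedBall, NNReal.dist_eq] at this
  exact NNReal.coe_le_coe.1 ((by simpa using this : (s : ℝ) ≤ r).trans (Real.le_coe_toNNReal r))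

theorem IsBddBorel.Iic (t : ℝ≥0) : IsBddBorel (Set.Iic t) :=
  ⟨measurableSet_Iic, by rw [← Set.Icc_bot]; exact Metric.isBounded_Icc _ _⟩

theorem IsBddBorel.inter {B A : Set ℝ≥0} (hB : IsBddBorel B) (hA : MeasurableSet A) :
    IsBddBorel (B ∩ A) :=
  ⟨hB.1.inter hA, hB.2.subset Set.inter_subset_left⟩

theorem IsBddBorel.lebesgueNNReal_lt_top {B : Set ℝ≥0} (hB : IsBddBorel B) :
    lebesgueNNReal B < ∞ := by
  obtain ⟨N, hN⟩ := hB.exists_le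
  exact (measure_mono hN).trans_lt (lebesgueNNReal_Iic_lt_top N)

theorem IsBddBorel.isBddSupp_indicator {B : Set ℝ≥0} (hB : IsBddBorel B) {f : ℝ≥0 → ℝ}
    (hf : Measurable f) {C : ℝ} (hC : ∀ s, ‖f s‖ ≤ C) : IsBddSupp (B.indicator f) := by
  obtain ⟨N, hN⟩ := hB.exists_le
  refine ⟨hf.indicator hB.1, ⟨C, fun s => (norm_indicator_le_norm_self _ _).trans (hC s)⟩, N,
    fun s hs => Set.indicator_of_notMem (fun h => not_le.2 hs (hN s h)) _⟩

theorem IsBddBorel.isBddSupp_indicator_one {B : Set ℝ≥0} (hB : IsBddBorel B) :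
    IsBddSupp (B.indicator fun _ => (1 : ℝ)) :=
  hB.isBddSupp_indicator measurable_const (C := 1) (by simp)

variable (P Y) in
/-- The random measure induced by a Lévy process. -/
def levyRandomMeasure (B : Set ℝ≥0) : Ω → EuclideanSpace ℝ (Fin d) :=
  levyVecIntegral P Y (B.indicator fun _ => 1)

namespace IsLevyProcess

variable [IsProbabilityMeasure P] (hY : IsLevyProcess P Y) (hψ : IsCumulant (P.map (Y 1)) ψ)
include hY hψ

theorem levyVecIntegral_congr_ae {f h : ℝ≥0 → ℝ} (hf : IsBddSupp f) (hh : IsBddSupp h)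
    (hfh : f =ᵐ[lebesgueNNReal] h) : levyVecIntegral P Y f =ᵐ[P] levyVecIntegral P Y h := by
  refine tendstoInMeasure_ae_unique (u := (atTop : Filter ℕ)) (TendstoInMeasure.const _)
    (hY.tendstoInMeasure_levyVecIntegral hψ (f := fun _ : ℕ => f) ?_ (fun _ => hf.measurable) hh)
  obtain ⟨C, hC⟩ := hf.bounded
  obtain ⟨N, hN⟩ := hf.support
  exact ⟨⟨C, fun _ => hC⟩, ⟨N, fun _ => hN⟩, hfh.mono fun s hs => hs ▸ tendsto_const_nhds⟩

theorem levyRandomMeasure_Ioc {s t : ℝ≥0} (hst : s ≤ t) :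
    levyRandomMeasure P Y (Set.Ioc s t) =ᵐ[P] fun ω => Y t ω - Y s ω := by
  have hB : IsBddBorel (Set.Ioc s t) := ⟨measurableSet_Ioc, Metric.isBounded_Ioc _ _⟩
  refine ae_eq_of_forall_inner_ae_eq fun z => ?_
  have h1 := hY.inner_levyVecIntegral hψ hB.isBddSupp_indicator_one z
  have h2 : (fun x => (Set.Ioc s t).indicator (fun _ => (1 : ℝ)) x • z) =
      stepFun (Finsupp.single t z - Finsupp.single s z) := by
    rw [stepFun_single_sub_single hst]
    ext1 x
    by_cases hx : x ∈ Set.Ioc s t <;>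
      simp only [Set.indicator, hx, if_true, if_false, one_smul, zero_smul]
  have h3 := hY.levyIntegral_stepFun hψ (Finsupp.single t z - Finsupp.single s z)
    (h2 ▸ hB.isBddSupp_indicator_one.smul_const z)
  rw [stepIntegral_single_sub_single, ← h2] at h3
  exact h1.trans h3

/-- The joint characteristic function factorises: disjointness and ψ(0) = 0 give ψ(∑ 1_{B_i} z_i) =
∑ 1_{B_i} ψ(z_i). -/
theorem iIndepFun_levyRandomMeasure {n : ℕ} {B : Fin n → Set ℝ≥0} (hB : ∀ i, IsBddBorel (B i))
    (hd : Pairwise (fun i j => Disjoint (B i) (B j))) :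
    iIndepFun (fun i => levyRandomMeasure P Y (B i)) P := by
  refine (iIndepFun_iff_charFun_pi (X := fun i => levyRandomMeasure P Y (B i))
    fun i => (measurable_levyVecIntegral _).aemeasurable).2 fun z => ?_
  have hm : AEMeasurable (fun ω => WithLp.toLp 2 fun i => levyRandomMeasure P Y (B i) ω) P :=
    ((WithLp.measurable_toLp 2 _).comp
      (measurable_pi_lambda _ fun _ => measurable_levyVecIntegral _)).aemeasurable
  have hb i := (hB i).isBddSupp_indicator_one
  have h1 := hY.integral_exp_sum_inner_levyVecIntegral hψ Finset.univ (fun i _ => hb i) z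
  have hind (w : EuclideanSpace ℝ (Fin d)) (A : Set ℝ≥0) (x : ℝ≥0) :
      A.indicator (fun _ => (1 : ℝ)) x • w = A.indicator (fun _ => w) x := by
    by_cases hx : x ∈ A <;> simp [hx]
  have hinner (v : Fin n → EuclideanSpace ℝ (Fin d)) :
      (inner ℝ (WithLp.toLp 2 v) z : ℝ) = ∑ i, inner ℝ (z i) (v i) := by
    rw [PiLp.inner_apply]
    exact Finset.sum_congr rfl fun i _ => real_inner_comm _ _
  rw [charFun_apply, integral_map hm (by fun_prop)]
  simp only [hinner]
  simp only [levyRandomMeasure] at h1 ⊢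
  simp_rw [fun i => hY.charFun_levyVecIntegral hψ (hb i), ← Complex.exp_sum]
  rw [h1]
  congr 1
  simp_rw [hind]
  rw [← integral_finsetSum]
  · refine integral_congr_ae (Eventually.of_forall fun x => ?_)
    simp only
    rw [comp_sum_indicator_of_pairwiseDisjoint hψ.2.1 _ _ fun i _ j _ hij => hd hij]
    refine Finset.sum_congr rfl fun i _ => ?_
    by_cases hx : x ∈ B i <;> simp [hx, hψ.2.1]
  · intro i _
    have : (fun x => ψ ((B i).indicator (fun _ => z i) x)) =
        (B i).indicator fun _ => ψ (z i) := by
      ext x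
      by_cases hx : x ∈ B i <;> simp [hx, hψ.2.1]
    rw [this, integrable_indicator_iff (hB i).1]
    exact integrableOn_const (hB i).lebesgueNNReal_lt_top.ne

theorem levyRandomMeasure_sigmaAdditive {B : ℕ → Set ℝ≥0} (hB : ∀ i, IsBddBorel (B i))
    (hd : Pairwise (fun i j => Disjoint (B i) (B j))) (hU : IsBddBorel (⋃ i, B i)) :
    TendstoInMeasure P (fun n ω => ∑ i ∈ Finset.range n, levyRandomMeasure P Y (B i) ω) atTop
      (levyRandomMeasure P Y (⋃ i, B i)) := by
  have hsum (n : ℕ) : (fun x => ∑ i ∈ Finset.range n, 1 * (B i).indicator (fun _ => (1 : ℝ)) x) =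
      (⋃ i ∈ Finset.range n, B i).indicator fun _ => (1 : ℝ) := by
    rw [Finset.indicator_biUnion _ _ fun i _ j _ hij => hd hij]
    simp
  have h1 (n : ℕ) := hY.levyVecIntegral_finsetSum hψ (Finset.range n) (fun _ => 1)
    fun i _ => (hB i).isBddSupp_indicator_one
  simp only [hsum, one_smul] at h1
  refine TendstoInMeasure.congr_left h1 ?_
  obtain ⟨N, hN⟩ := hU.exists_le
  refine hY.tendstoInMeasure_levyVecIntegral hψ ⟨⟨1, fun n s => ?_⟩, ⟨N, fun n s hs => ?_⟩, ?_⟩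
    (fun n => ?_) hU.isBddSupp_indicator_one
  · exact (norm_indicator_le_norm_self _ _).trans (by simp)
  · refine Set.indicator_of_notMem (fun h => not_le.2 hs (hN s ?_)) _
    exact Set.iUnion₂_subset (fun i _ => Set.subset_iUnion B i) h
  · refine Eventually.of_forall fun s => ?_
    exact ((tendsto_indicator_biUnion_finset B (fun _ => (1 : ℝ)) s).mono_right
      (pure_le_nhds _)).comp tendsto_finset_range
  · exact measurable_const.indicator (Finset.measurableSet_biUnion _ fun i _ => (hB i).1)

theorem isRandomMeasureOf_levyRandomMeasure : IsRandomMeasureOf P Y (levyRandomMeasure P Y) where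
  measurable _ _ := measurable_levyVecIntegral _
  singleton_zero := by
    -- The empty sum shows that the zero function has integral 0 almost surely.
    have h0 := hY.levyVecIntegral_finsetSum hψ (∅ : Finset ℕ) (f := fun _ _ => 0) (fun _ => 0)
      (by simp)
    simp only [Finset.sum_empty] at h0
    have hB : IsBddBorel ({0} : Set ℝ≥0) :=
      ⟨measurableSet_singleton 0, Bornology.isBounded_singleton⟩
    refine (hY.levyVecIntegral_congr_ae hψ hB.isBddSupp_indicator_one
      (IsBddSupp.submodule ℝ).zero_mem ?_).trans h0
    exact indicator_meas_zero (lebesgueNNReal_singleton 0)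
  Ioc _ _ hst := hY.levyRandomMeasure_Ioc hψ hst
  indep _ _ hB hd := hY.iIndepFun_levyRandomMeasure hψ hB hd
  sigmaAdditive _ hB hd hU := hY.levyRandomMeasure_sigmaAdditive hψ hB hd hU

theorem simpleStochIntegral_levyRandomMeasure (g : SimpleFunc ℝ≥0 ℝ) {B : Set ℝ≥0}
    (hB : IsBddBorel B) : simpleStochIntegral (levyRandomMeasure P Y) g B =ᵐ[P]
      levyVecIntegral P Y (B.indicator g) := by
  have h1 := hY.levyVecIntegral_finsetSum hψ g.range id
    (f := fun a => (B ∩ g ⁻¹' {a}).indicator fun _ => (1 : ℝ))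
    fun a _ => (hB.inter (g.measurableSet_fiber a)).isBddSupp_indicator_one
  have h2 : (fun x => ∑ a ∈ g.range, id a * (B ∩ g ⁻¹' {a}).indicator (fun _ => (1 : ℝ)) x) =
      B.indicator g := by
    ext x
    rw [Finset.sum_eq_single_of_mem (g x) (g.mem_range_self x)]
    · by_cases hx : x ∈ B <;> simp [hx]
    · intro a _ ha
      rw [Set.indicator_of_notMem (fun h => ha h.2.symm), mul_zero]
  rw [h2] at h1
  exact h1.symm

theorem isStochIntegral_levyVecIntegral {f : ℝ≥0 → ℝ} (hf : Measurable f) {C : ℝ}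
    (hC : ∀ s, ‖f s‖ ≤ C) : IsStochIntegral P (levyRandomMeasure P Y) f
      (fun B => levyVecIntegral P Y (B.indicator f)) := by
  have hlim (s : ℝ≥0) : Tendsto (fun n => SimpleFunc.approxOn f hf Set.univ 0 (Set.mem_univ 0) n s)
      atTop (𝓝 (f s)) := SimpleFunc.tendsto_approxOn hf _ (by simp)
  refine ⟨SimpleFunc.approxOn f hf Set.univ 0 (Set.mem_univ 0), Eventually.of_forall hlim,
    fun B hB => ?_⟩
  refine TendstoInMeasure.congr_left
    (fun n => (hY.simpleStochIntegral_levyRandomMeasure hψ _ hB).symm) ?_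
  obtain ⟨N, hN⟩ := hB.exists_le
  refine hY.tendstoInMeasure_levyVecIntegral hψ ⟨⟨C + C, fun n s => ?_⟩, ⟨N, fun n s hs => ?_⟩, ?_⟩
    (fun n => (SimpleFunc.measurable _).indicator hB.1) (hB.isBddSupp_indicator hf hC)
  -- Approximants based at 0 have norm at most 2‖f(s)‖, hence the uniform bound C + C.
  · exact (norm_indicator_le_norm_self _ _).trans
      ((SimpleFunc.norm_approxOn_zero_le hf _ s n).trans (add_le_add (hC s) (hC s)))
  · exact Set.indicator_of_notMem (fun h => not_le.2 hs (hN s h)) _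
  · refine Eventually.of_forall fun s => ?_
    by_cases hs : s ∈ B
    · simpa [hs] using hlim s
    · simp [hs]

/-- At each s the difference of the two truncations is f(s), -f(s) or 0. The exponent is therefore
dominated by |ψ(f(s)uv)| + |ψ(-f(s)uv)|, and it vanishes once both truncation times pass s. -/
theorem tendstoInMeasure_levyVecIntegral_Iic_sub {f : ℝ≥0 → ℝ} (hf : Measurable f) {C : ℝ}
    (hC : ∀ s, ‖f s‖ ≤ C) (hint : ∀ z, Integrable (fun s => ψ (f s • z)) lebesgueNNReal) :
    TendstoInMeasure P (fun (p : ℝ≥0 × ℝ≥0) ω =>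
      levyVecIntegral P Y ((Set.Iic p.1).indicator f) ω -
        levyVecIntegral P Y ((Set.Iic p.2).indicator f) ω) (atTop ×ˢ atTop) 0 := by
  have hb (t : ℝ≥0) := (IsBddBorel.Iic t).isBddSupp_indicator hf hC
  refine TendstoInMeasure.euclidean fun j => ?_
  set v : EuclideanSpace ℝ (Fin d) := EuclideanSpace.single j 1 with hv
  refine TendstoInMeasure.congr_left (fun p => hY.levyIntegral_sub hψ ((hb p.1).smul_const v)
    ((hb p.2).smul_const v)) (hY.tendstoInMeasure_levyIntegral_zero_of_tendsto hψ
      (h := fun (p : ℝ≥0 × ℝ≥0) s =>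
        (Set.Iic p.1).indicator f s • v - (Set.Iic p.2).indicator f s • v)
      (fun p => ((hb p.1).smul_const v).sub ((hb p.2).smul_const v)) fun u => ?_)
  have h0 : (0 : ℂ) = ∫ _, (0 : ℂ) ∂lebesgueNNReal := by simp
  rw [h0]
  refine tendsto_integral_filter_of_dominated_convergence
    (fun s => ‖ψ (f s • (u • v))‖ + ‖ψ (f s • (-u • v))‖)
    (Eventually.of_forall fun p => ?_) (Eventually.of_forall fun p => Eventually.of_forall
      fun s => ?_) ((hint _).norm.add (hint _).norm) (Eventually.of_forall fun s => ?_)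
  · exact (hψ.1.measurable.comp ((((hb p.1).smul_const v).sub
      ((hb p.2).smul_const v)).measurable.const_smul u)).aestronglyMeasurable
  · have e1 : u • f s • v = f s • u • v := smul_comm _ _ _
    have e2 : u • -(f s • v) = f s • -u • v := by rw [smul_neg, smul_comm, neg_smul, smul_neg]
    by_cases h1 : s ≤ p.1 <;> by_cases h2 : s ≤ p.2 <;>
      simp only [Set.indicator, Set.mem_Iic, h1, h2, if_true, if_false, zero_smul, sub_zero,
        zero_sub, sub_self, smul_zero, hψ.2.1, norm_zero, e1, e2]
    · positivity
    · exact le_add_of_nonneg_right (norm_nonneg _)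
    · exact le_add_of_nonneg_left (norm_nonneg _)
    · positivity
  · refine tendsto_const_nhds.congr' ?_
    filter_upwards [tendsto_fst.eventually_ge_atTop s, tendsto_snd.eventually_ge_atTop s]
      with p h1 h2
    simp [h1, h2, hψ.2.1]

/-- If `ψ(f(s) z)` is integrable over `[0,∞)` for all `z`, then `∫₀^∞ f dY` is definable and its
characteristic function is `z ↦ exp ∫₀^∞ ψ(f(s) z) ds`. -/
theorem exists_isImproperStochIntegral {f : ℝ≥0 → ℝ} (hf : Measurable f) {C : ℝ}
    (hC : ∀ s, ‖f s‖ ≤ C) (hint : ∀ z, Integrable (fun s => ψ (f s • z)) lebesgueNNReal) :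
    ∃ Z : Ω → EuclideanSpace ℝ (Fin d), Measurable Z ∧ IsImproperStochIntegral P Y f Z ∧
      ∀ z, charFun (P.map Z) z = Complex.exp (∫ s, ψ (f s • z) ∂lebesgueNNReal) := by
  have hb (t : ℝ≥0) := (IsBddBorel.Iic t).isBddSupp_indicator hf hC
  have hc := hY.tendstoInMeasure_levyVecIntegral_Iic_sub hψ hf hC hint
  have hnat : Tendsto (fun n : ℕ => (n : ℝ≥0)) atTop atTop := tendsto_natCast_atTop_atTop
  have hcn : TendstoInMeasure P (fun (p : ℕ × ℕ) ω =>
      levyVecIntegral P Y ((Set.Iic (p.1 : ℝ≥0)).indicator f) ω -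
        levyVecIntegral P Y ((Set.Iic (p.2 : ℝ≥0)).indicator f) ω) (atTop ×ˢ atTop) 0 := by
    have hp : Tendsto (fun p : ℕ × ℕ => ((p.1 : ℝ≥0), (p.2 : ℝ≥0))) (atTop ×ˢ atTop)
        (atTop ×ˢ atTop) := (hnat.comp tendsto_fst).prodMk (hnat.comp tendsto_snd)
    have h2 := hc.comp hp
    simp only [Function.comp_def] at h2
    exact h2
  obtain ⟨Z, hZm, hZ⟩ := exists_tendstoInMeasure_of_cauchy
    (X := fun n : ℕ => levyVecIntegral P Y ((Set.Iic (n : ℝ≥0)).indicator f))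
    (fun n => (measurable_levyVecIntegral _).aestronglyMeasurable) hcn
  refine ⟨Z, hZm.measurable, ⟨levyRandomMeasure P Y,
    fun B => levyVecIntegral P Y (B.indicator f), hY.isRandomMeasureOf_levyRandomMeasure hψ,
    hY.isStochIntegral_levyVecIntegral hψ hf hC, ?_⟩, fun z => ?_⟩
  -- The limit was found along integer times; comparing t with ⌈t⌉ extends it to all real times.
  · have hceil : Tendsto (fun t : ℝ≥0 => ⌈t⌉₊) atTop atTop := tendsto_nat_ceil_atTop
    have h1 := (hc.comp (tendsto_id.prodMk (hnat.comp hceil))).add (hZ.comp hceil)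
    simp only [Function.comp_def, id, sub_add_cancel, Pi.zero_apply, zero_add] at h1
    exact h1
  · have h1 := tendsto_charFun_of_tendstoInMeasure
      (fun n : ℕ => measurable_levyVecIntegral ((Set.Iic (n : ℝ≥0)).indicator f))
      hZm.measurable hZ z
    simp_rw [hY.charFun_levyVecIntegral hψ (hb _)] at h1
    refine tendsto_nhds_unique h1 ((Complex.continuous_exp.tendsto _).comp ?_)
    refine tendsto_integral_of_dominated_convergence (fun s => ‖ψ (f s • z)‖)
      (fun n => (hψ.1.measurable.comp ((hb n).smul_const z).measurable).aestronglyMeasurable)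
      (hint z).norm (fun n => Eventually.of_forall fun s => ?_) (Eventually.of_forall fun s => ?_)
    · by_cases hs : s ≤ n <;> simp [hs, hψ.2.1]
    · refine tendsto_const_nhds.congr' ?_
      filter_upwards [hnat.eventually_ge_atTop s] with n hn
      simp [hn]

end IsLevyProcess
end RandomMeasure

end

/-! ### The exponent of ID₀. -/

noncomputable section

section Exponent

variable {d : ℕ}

theorem norm_exp_I_mul_sub_one_le_two (x : ℝ) : ‖Complex.exp (Complex.I * x) - 1‖ ≤ 2 := by
  refine (norm_sub_le _ _).trans ?_
  rw [mul_comm, Complex.norm_exp_ofReal_mul_I]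
  norm_num

/-- Finiteness of M makes the constant 2 an integrable bound, which gives continuity. -/
theorem isCumulant_cgfID0 {M : Measure (EuclideanSpace ℝ (Fin d))} [IsFiniteMeasure M]
    {γ : EuclideanSpace ℝ (Fin d)} {μ : Measure (EuclideanSpace ℝ (Fin d))} (h : IsID0 M γ μ) :
    IsCumulant μ (cgfID0 M γ) := by
  refine ⟨?_, by simp [cgfID0], h.charFun_eq⟩
  refine Continuous.add (by fun_prop) (continuous_of_dominated (bound := fun _ => 2)
    (fun z => ?_) (fun z => Eventually.of_forall fun x => norm_exp_I_mul_sub_one_le_two _)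
    (integrable_const _) (Eventually.of_forall fun x => by fun_prop))
  exact Continuous.aestronglyMeasurable (by fun_prop)

theorem integrable_exp_inner_sub_one {M : Measure (EuclideanSpace ℝ (Fin d))}
    (hM : ∫⁻ x, ENNReal.ofReal (min ‖x‖ 1) ∂M < ∞) (z : EuclideanSpace ℝ (Fin d)) :
    Integrable (fun x => Complex.exp (Complex.I * (inner ℝ z x : ℝ)) - 1) M := by
  have hint : Integrable (fun x : EuclideanSpace ℝ (Fin d) => min ‖x‖ 1) M := by
    refine ⟨Continuous.aestronglyMeasurable (by fun_prop), ?_⟩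
    rw [hasFiniteIntegral_iff_ofReal (Eventually.of_forall fun x => by positivity)]
    exact hM
  refine (hint.const_mul (max ‖z‖ 2)).mono' (Continuous.aestronglyMeasurable (by fun_prop))
    (Eventually.of_forall fun x => ?_)
  rcases le_total ‖x‖ 1 with h | h
  · rw [min_eq_left h]
    refine (Real.norm_exp_I_mul_ofReal_sub_one_le).trans ?_
    refine (norm_inner_le_norm z x).trans ?_
    gcongr
    exact le_max_left _ _
  · rw [min_eq_right h, mul_one]
    exact (norm_exp_I_mul_sub_one_le_two _).trans (le_max_right _ _)

end Exponent

/-! ### The substitution r = f(s). -/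

section ChangeOfVariables

variable {α θ : ℝ}

/-- The kernel `s ↦ exp(-(α s / θ)^(1/α))`. -/
def expKernel (α θ : ℝ) (s : ℝ) : ℝ := Real.exp (-(α * s / θ) ^ (1 / α))

theorem measurable_expKernel : Measurable (expKernel α θ) := by
  unfold expKernel
  fun_prop

theorem expKernel_inverse (hα : 0 < α) (hθ : 0 < θ) {r : ℝ} (hr : r ∈ Set.Ioo (0 : ℝ) 1) :
    expKernel α θ (θ / α * (-Real.log r) ^ α) = r := by
  have hlog : 0 ≤ -Real.log r := by linarith [Real.log_neg hr.1 hr.2]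
  have : α * (θ / α * (-Real.log r) ^ α) / θ = (-Real.log r) ^ α := by field_simp
  rw [expKernel, this, ← Real.rpow_mul hlog, mul_one_div_cancel hα.ne', Real.rpow_one, neg_neg,
    Real.exp_log hr.1]

theorem image_inverse_expKernel (hα : 0 < α) (hθ : 0 < θ) :
    (fun r => θ / α * (-Real.log r) ^ α) '' Set.Ioo (0 : ℝ) 1 = Set.Ioi 0 := by
  ext s
  constructor
  · rintro ⟨r, hr, rfl⟩
    have : 0 < -Real.log r := by linarith [Real.log_neg hr.1 hr.2]
    simp only [Set.mem_Ioi]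
    positivity
  · intro hs
    have hs : 0 < s := hs
    have h0 : 0 < α * s / θ := by positivity
    refine ⟨expKernel α θ s, ⟨Real.exp_pos _, ?_⟩, ?_⟩
    · rw [expKernel, Real.exp_lt_one_iff]
      have : 0 < (α * s / θ) ^ (1 / α) := Real.rpow_pos_of_pos h0 _
      linarith
    · simp only [expKernel, Real.log_exp, neg_neg]
      rw [← Real.rpow_mul h0.le, one_div_mul_cancel hα.ne', Real.rpow_one]
      field_simp

/-- The inverse of the kernel, r ↦ (θ/α)(-log r)^α, maps (0,1) onto (0,∞), and the modulus of its
derivative is θ times the density of `logPowerMeasure`. -/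
theorem map_expKernel_lebesgueNNReal (hα : 0 < α) (hθ : 0 < θ) :
    lebesgueNNReal.map (fun s : ℝ≥0 => expKernel α θ s) =
      ENNReal.ofReal θ • logPowerMeasure α := by
  have h1 : lebesgueNNReal.map (fun s : ℝ≥0 => expKernel α θ s) =
      (volume.restrict (Set.Ioi 0)).map (expKernel α θ) := by
    rw [restrict_Ioi_eq_restrict_Ici, ← map_coe_lebesgueNNReal,
      Measure.map_map measurable_expKernel measurable_coe_nnreal_real]
    rfl
  rw [h1]
  ext A hA
  have hderiv : ∀ r ∈ Set.Ioo (0 : ℝ) 1, HasDerivWithinAt (fun r => θ / α * (-Real.log r) ^ α)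
      (-(θ * ((-Real.log r) ^ (α - 1) * r⁻¹))) (Set.Ioo 0 1) r := by
    intro r hr
    have hlog : 0 < -Real.log r := by linarith [Real.log_neg hr.1 hr.2]
    have h := (((Real.hasDerivAt_log hr.1.ne').neg.rpow_const (p := α) (Or.inl hlog.ne')).const_mul
      (θ / α)).hasDerivWithinAt (s := Set.Ioo 0 1)
    refine h.congr_deriv ?_
    simp only [Pi.neg_apply]
    field_simp
  have hinj : Set.InjOn (fun r => θ / α * (-Real.log r) ^ α) (Set.Ioo (0 : ℝ) 1) :=
    fun a ha b hb hab => by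
      rw [← expKernel_inverse hα hθ ha, ← expKernel_inverse hα hθ hb]
      exact congrArg _ hab
  rw [← lintegral_indicator_one hA, lintegral_map (measurable_one.indicator hA)
    measurable_expKernel,
    ← image_inverse_expKernel hα hθ,
    lintegral_image_eq_lintegral_abs_deriv_mul measurableSet_Ioo hderiv hinj,
    Measure.smul_apply, smul_eq_mul, logPowerMeasure, withDensity_apply _ hA,
    ← lintegral_indicator hA, ← lintegral_const_mul _ (by
      refine Measurable.indicator ?_ hA
      fun_prop)]
  refine setLIntegral_congr_fun measurableSet_Ioo fun r hr => ?_
  have hlog : 0 < -Real.log r := by linarith [Real.log_neg hr.1 hr.2]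
  have hr0 := hr.1
  rw [expKernel_inverse hα hθ hr, abs_neg, abs_of_nonneg (by positivity)]
  by_cases hrA : r ∈ A
  · simp [hrA, ENNReal.ofReal_mul hθ.le]
  · simp [hrA]

theorem integral_expKernel (hα : 0 < α) (hθ : 0 < θ) :
    ∫ s : ℝ≥0, expKernel α θ s ∂lebesgueNNReal = θ * Real.Gamma α := by
  have h1 : ∫ s : ℝ≥0, expKernel α θ s ∂lebesgueNNReal =
      ∫ s in Set.Ioi (0 : ℝ), expKernel α θ s := by
    rw [restrict_Ioi_eq_restrict_Ici, ← map_coe_lebesgueNNReal,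
      measurableEmbedding_nnreal_coe.integral_map]
  have h2 : ∀ s ∈ Set.Ioi (0 : ℝ), expKernel α θ s =
      Real.exp (-(α / θ) ^ (1 / α) * s ^ (1 / α)) := fun s hs => by
    rw [expKernel, mul_div_right_comm, Real.mul_rpow (by positivity) (le_of_lt hs), neg_mul]
  rw [h1, setIntegral_congr_fun measurableSet_Ioi h2,
    integral_exp_neg_mul_rpow (by positivity) (by positivity), ← Real.rpow_mul (by positivity)]
  have h3 : 1 / α * (-1 / (1 / α)) = -1 := by field_simp
  rw [h3, Real.rpow_neg_one, one_div_one_div, Real.Gamma_add_one hα.ne']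
  field_simp

theorem integrable_expKernel (hα : 0 < α) (hθ : 0 < θ) :
    Integrable (fun s : ℝ≥0 => expKernel α θ s) lebesgueNNReal := by
  -- The Bochner integral of a non-integrable function is 0, so the positive value just computed
  -- forces integrability.
  refine Integrable.of_integral_ne_zero ?_
  rw [integral_expKernel hα hθ]
  have := Real.Gamma_pos_of_pos hα
  positivity

end ChangeOfVariables

/-! ### The integrated cumulant is the exponent of ID₀(M_α, γ). -/

section Cumulant

variable {d : ℕ} {α θ : ℝ} {ν : Measure (EuclideanSpace ℝ (Fin d))}

instance sFinite_logPowerMeasure : SFinite (logPowerMeasure α) := by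
  unfold logPowerMeasure
  infer_instance

theorem integrable_prod_of_levyMeasureOfBDLM [SFinite ν]
    (hM : ∫⁻ x, ENNReal.ofReal (min ‖x‖ 1) ∂(levyMeasureOfBDLM α ν) < ∞)
    (z : EuclideanSpace ℝ (Fin d)) :
    Integrable (fun p : EuclideanSpace ℝ (Fin d) × ℝ =>
      Complex.exp (Complex.I * (inner ℝ (p.2 • z) p.1 : ℝ)) - 1) (ν.prod (logPowerMeasure α)) := by
  have h := integrable_exp_inner_sub_one hM z
  rw [levyMeasureOfBDLM, integrable_map_measure
    (Continuous.aestronglyMeasurable (by fun_prop)) (by fun_prop)] at h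
  refine h.congr (Eventually.of_forall fun p => ?_)
  simp only [Function.comp_apply, inner_smul_left, inner_smul_right]
  rfl

theorem integral_levyMeasureOfBDLM [SFinite ν]
    (hM : ∫⁻ x, ENNReal.ofReal (min ‖x‖ 1) ∂(levyMeasureOfBDLM α ν) < ∞)
    (z : EuclideanSpace ℝ (Fin d)) :
    ∫ x, (Complex.exp (Complex.I * (inner ℝ z x : ℝ)) - 1) ∂(levyMeasureOfBDLM α ν) =
      ∫ r, ∫ x, (Complex.exp (Complex.I * (inner ℝ (r • z) x : ℝ)) - 1) ∂ν
        ∂(logPowerMeasure α) := by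
  rw [levyMeasureOfBDLM, integral_map (by fun_prop)
    (Continuous.aestronglyMeasurable (by fun_prop)),
    ← integral_prod_symm _ (integrable_prod_of_levyMeasureOfBDLM hM z)]
  refine integral_congr_ae (Eventually.of_forall fun p => ?_)
  simp only [inner_smul_left, inner_smul_right]
  rfl

/-- As functions of s, both integrands depend on s only through the kernel. The pushforward formula
thus reduces both claims to Fubini for ν times `logPowerMeasure`. -/
theorem integrable_expKernel_cumulant [SFinite ν] (hα : 0 < α) (hθ : 0 < θ)
    (hM : ∫⁻ x, ENNReal.ofReal (min ‖x‖ 1) ∂(levyMeasureOfBDLM α ν) < ∞)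
    (z : EuclideanSpace ℝ (Fin d)) :
    Integrable (fun s : ℝ≥0 => ∫ x, (Complex.exp (Complex.I *
      (inner ℝ (expKernel α θ s • z) x : ℝ)) - 1) ∂ν) lebesgueNNReal ∧
    ∫ s : ℝ≥0, ∫ x, (Complex.exp (Complex.I *
      (inner ℝ (expKernel α θ s • z) x : ℝ)) - 1) ∂ν ∂lebesgueNNReal =
      θ * ∫ x, (Complex.exp (Complex.I * (inner ℝ z x : ℝ)) - 1) ∂(levyMeasureOfBDLM α ν) := by
  set G : ℝ → ℂ := fun r => ∫ x, (Complex.exp (Complex.I * (inner ℝ (r • z) x : ℝ)) - 1) ∂ν with hG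
  have hGi : Integrable G (logPowerMeasure α) :=
    (integrable_prod_of_levyMeasureOfBDLM hM z).integral_prod_right
  have hGi' : Integrable G (ENNReal.ofReal θ • logPowerMeasure α) :=
    hGi.smul_measure ENNReal.ofReal_ne_top
  have hk : Measurable fun s : ℝ≥0 => expKernel α θ s :=
    measurable_expKernel.comp measurable_coe_nnreal_real
  have hmap := map_expKernel_lebesgueNNReal hα hθ
  rw [← hmap] at hGi'
  constructor
  · exact (integrable_map_measure hGi'.1 hk.aemeasurable).1 hGi'
  · rw [integral_levyMeasureOfBDLM hM z]
    have h := integral_map hk.aemeasurable hGi'.1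
    rw [hmap, integral_smul_measure, ENNReal.toReal_ofReal hθ.le] at h
    rw [← h, Complex.real_smul]

theorem cgfID0_smul_smul (hθ : 0 < θ) (γ z : EuclideanSpace ℝ (Fin d)) (r : ℝ) :
    cgfID0 (ENNReal.ofReal θ⁻¹ • ν) γ (r • z) = Complex.I * (inner ℝ γ z : ℝ) * r +
      (θ⁻¹ : ℝ) * ∫ x, (Complex.exp (Complex.I * (inner ℝ (r • z) x : ℝ)) - 1) ∂ν := by
  rw [cgfID0, integral_smul_measure, ENNReal.toReal_ofReal (by positivity), Complex.real_smul,
    inner_smul_right]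
  push_cast
  ring

theorem integrable_cgfID0_expKernel [SFinite ν] (hα : 0 < α) (hθ : 0 < θ)
    (hM : ∫⁻ x, ENNReal.ofReal (min ‖x‖ 1) ∂(levyMeasureOfBDLM α ν) < ∞)
    (γ z : EuclideanSpace ℝ (Fin d)) :
    Integrable (fun s : ℝ≥0 => cgfID0 (ENNReal.ofReal θ⁻¹ • ν) γ (expKernel α θ s • z))
      lebesgueNNReal := by
  simp_rw [cgfID0_smul_smul hθ]
  exact ((integrable_expKernel hα hθ).ofReal.const_mul _).add
    ((integrable_expKernel_cumulant hα hθ hM z).1.const_mul _)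

theorem integral_cgfID0_expKernel [SFinite ν] (hα : 0 < α) (hθ : 0 < θ)
    (hM : ∫⁻ x, ENNReal.ofReal (min ‖x‖ 1) ∂(levyMeasureOfBDLM α ν) < ∞)
    (γ z : EuclideanSpace ℝ (Fin d)) :
    ∫ s : ℝ≥0, cgfID0 (ENNReal.ofReal θ⁻¹ • ν) ((θ * Real.Gamma α)⁻¹ • γ) (expKernel α θ s • z)
      ∂lebesgueNNReal = cgfID0 (levyMeasureOfBDLM α ν) γ z := by
  have h := integrable_expKernel_cumulant hα hθ hM z
  have hθ0 : (θ : ℂ) ≠ 0 := by exact_mod_cast hθ.ne'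
  have hΓ : (Real.Gamma α : ℂ) ≠ 0 := by exact_mod_cast (Real.Gamma_pos_of_pos hα).ne'
  have hk : Integrable (fun s : ℝ≥0 => (expKernel α θ s : ℂ)) lebesgueNNReal :=
    (integrable_expKernel hα hθ).ofReal
  simp_rw [cgfID0_smul_smul hθ]
  rw [integral_add (hk.const_mul _) (h.1.const_mul _),
    integral_const_mul, integral_const_mul, h.2, integral_complex_ofReal, integral_expKernel hα hθ,
    cgfID0, real_inner_smul_left]
  push_cast
  field_simp

end Cumulant

end

/-! ### The theorem, by uniqueness of characteristic functions. -/

theorem theorem1 {d : ℕ} {Ω Ω' : Type*} [MeasurableSpace Ω] [MeasurableSpace Ω']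
    (P : Measure Ω) [IsProbabilityMeasure P] (P' : Measure Ω') [IsProbabilityMeasure P']
    (α θ : ℝ) (hθ : 0 < θ)
    (ν : Measure (EuclideanSpace ℝ (Fin d))) (γ : EuclideanSpace ℝ (Fin d))
    (X : Ω' → EuclideanSpace ℝ (Fin d)) (hX : Measurable X)
    (hXlaw : IsLStar α ν γ (P'.map X))
    (Y : ℝ≥0 → Ω → EuclideanSpace ℝ (Fin d)) (hY : IsLevyProcess P Y)
    (hY1 : IsID0 (ENNReal.ofReal θ⁻¹ • ν) ((θ * Real.Gamma α)⁻¹ • γ) (P.map (Y 1))) :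
    IsAbsolutelyDefinable P Y (fun s => Real.exp (-(α * (s : ℝ) / θ) ^ (1 / α))) ∧
    ∃ Z : Ω → EuclideanSpace ℝ (Fin d),
      IsImproperStochIntegral P Y (fun s => Real.exp (-(α * (s : ℝ) / θ) ^ (1 / α))) Z ∧
      IdentDistrib X Z P' P := by
  have hα := hXlaw.pos
  have := hXlaw.isFiniteMeasure
  have hM := hXlaw.isID0.lintegral_lt_top
  have : IsFiniteMeasure (ENNReal.ofReal θ⁻¹ • ν) := ν.smul_finite ENNReal.ofReal_ne_top
  have hψ := isCumulant_cgfID0 hY1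
  have hint (z : EuclideanSpace ℝ (Fin d)) :=
    integrable_cgfID0_expKernel hα hθ hM ((θ * Real.Gamma α)⁻¹ • γ) z
  have hmeas : Measurable fun s : ℝ≥0 => expKernel α θ s :=
    measurable_expKernel.comp measurable_coe_nnreal_real
  have hbd (s : ℝ≥0) : ‖expKernel α θ s‖ ≤ 1 := by
    rw [expKernel, Real.norm_of_nonneg (Real.exp_pos _).le, Real.exp_le_one_iff, neg_nonpos]
    positivity
  obtain ⟨Z, hZm, hZ, hZchar⟩ := hY.exists_isImproperStochIntegral hψ hmeas hbd hint
  refine ⟨⟨⟨Z, hZ⟩, _, hψ, hint⟩, Z, hZ, hX.aemeasurable, hZm.aemeasurable, ?_⟩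
  have := Measure.isProbabilityMeasure_map (μ := P') hX.aemeasurable
  have := Measure.isProbabilityMeasure_map (μ := P) hZm.aemeasurable
  refine Measure.ext_of_charFun (funext fun z => ?_)
  rw [hXlaw.isID0.charFun_eq, hZchar, integral_cgfID0_expKernel hα hθ hM]
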